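/- Let $(\Omega,\mathcal F,P)$ be a probability space, $\mathbb K\in\{\mathbb R,\mathbb C\}$, and let $L^0(\mathcal F,\mathbb K)$ be the algebra of almost sure equivalence classes of $\mathbb K$-valued random variables; inequalities in $L^0(\mathcal F,\mathbb R)$ are meant almost surely, and $L^0_+(\mathcal F)=\{\zeta\in L^0(\mathcal F,\mathbb R):\zeta\ge 0\}$. Let $(S,\|\cdot\|)$ be a random normed module over $\mathbb K$ with base $(\Omega,\mathcal F,P)$, i.e. $S$ is a module over $L^0(\mathcal F,\mathbb K)$ and $\|\cdot\|:S\to L^0_+(\mathcal F)$ satisfies $\|x\|=0\Rightarrow x=0$, $\|\zeta x\|=|\zeta|\,\|x\|$ for $\zeta \in L^0(\mathcal F,\mathbb K)$, and $\|x+y\|\le\|x\|+\|y\|$. Equip $S$ with the $(\varepsilon,\lambda)$-topology, whose neighbourhoods of $0$ have the base of sets $\{z: P[\|z\|<\varepsilon]>1-\lambda\}$, $\varepsilon>0$, $0<\lambda<1$, and assume that $S$ is complete for it. All limits, continuity and density in $S$ refer to this topology. A $\mathbb K$-linear operator $T:S\to S$ is almost surely bounded, $T\in B(S)$, if there is an $\eta\in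 L^0_+(\mathcal F)$ with $\|Tz\|\le\eta\|z\|$ for all $z\in S$; $\|T\|$ is the infimum in $L^0(\mathcal F,\mathbb R)$ of all such $\eta$. Let $C\in B(S)$ be injective. A $C$-semigroup is a family $\{W(s):s\ge0\}\subseteq B(S)$ with $W(0)=C$, $CW(s+t)=W(t)W(s)$ for all $s,t\ge0$, and $s\mapsto W(s)x$ continuous on $[0,\infty)$ for every $x\in S$. For $M\in L^0_+(\mathcal F)$ and $\xi\in L^0(\mathcal F,\mathbb R)$, let $H(M,\xi)$ be the set of all $C$-semigroups with $\|W(s)\|\le Me^{\xi s}$ for all $s\ge0$. The infinitesimal generator $A:D(A)\to S$ has as its domain $D(A)$ the set of all $x\in S$ for which $\lim_{s\to0^+}\frac{W(s)x-Cx}{s}$ exists and belongs to the range $R(C)$ of $C$, and $Ax=C^{-1}\lim_{s\to0^+}\frac{W(s)x-Cx}{s}$. The $C$-resolvent set $\rho_C(A)$ is the set of all $\eta\in L^0(\mathcal F,\mathbb K)$ such that $\eta-A:D(A)\to S$ is injective and $R(C)\subseteq R(\eta-A)$, and for such $\eta$, $R_C(\eta,A)=(\eta-A)^{-1}C:S\to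 D(A)$. Let $G_\xi=\{\eta\in L^0(\mathcal F,\mathbb R):\eta>\xi \text{ almost surely}\}$. **Lemma 4.10.** Suppose that $\{W(s):s\ge0\}$ belongs to $H(M,\xi)$, that $(A,D(A))$ is its infinitesimal generator, and that $R(C)$ is dense in $S$. Then $G_\xi\subseteq\rho_C(A)$, and as $\eta\to\infty$ with $\eta\in G_\xi$: (a) $\eta R_C(\eta,A)x\to Cx$ for every $x\in S$; (b) for every $x\in D(A)$, $\eta AR_C(\eta,A)x=\eta R_C(\eta,A)Ax$ for all $\eta\in G_\xi$, and $$\lim_{\eta\to\infty}\eta AR_C(\eta,A)x=\lim_{\eta\to\infty}\eta R_C(\eta,A)Ax=CAx.$$ Here $\eta\to\infty$ is meant in probability: the limits are taken along the filter on $G_\xi$ generated by the sets $\{\eta\in G_\xi:P[\eta>N]>1-\delta\}$, $N\in\mathbb R$, $\delta>0$. -/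

import Mathlib

open MeasureTheory Filter Topology
open scoped NNReal ENNReal

noncomputable section

namespace RandomNormed

/-! ### The algebra `L⁰(F, 𝕜)` of classes of random variables, as `Ω →ₘ[P] 𝕜` -/

section L0

variable {Ω : Type*} [MeasurableSpace Ω] {P : Measure Ω}

/-- Almost everywhere equality classes with values in a topological commutative ring form a
commutative ring, with the pointwise operations that Mathlib already puts on them. -/
instance instCommRingL0 {R : Type*} [TopologicalSpace R] [CommRing R] [IsTopologicalRing R] :
    CommRing (Ω →ₘ[P] R) :=
  { (inferInstance : AddCommGroup (Ω →ₘ[P] R)), (inferInstance : CommMonoid (Ω →ₘ[P] R)) with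
    left_distrib := fun a b c => AEEqFun.toGerm_injective (by
      simp only [AEEqFun.mul_toGerm, AEEqFun.add_toGerm, mul_add])
    right_distrib := fun a b c => AEEqFun.toGerm_injective (by
      simp only [AEEqFun.mul_toGerm, AEEqFun.add_toGerm, add_mul])
    zero_mul := fun a => AEEqFun.toGerm_injective (by
      simp only [AEEqFun.mul_toGerm, AEEqFun.zero_toGerm, zero_mul])
    mul_zero := fun a => AEEqFun.toGerm_injective (by
      simp only [AEEqFun.mul_toGerm, AEEqFun.zero_toGerm, mul_zero]) }

/-- The absolute value `|ζ| ∈ L⁰(F, ℝ)` of `ζ ∈ L⁰(F, 𝕜)`. -/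
def absL0 {𝕜 : Type*} [RCLike 𝕜] (ζ : Ω →ₘ[P] 𝕜) : Ω →ₘ[P] ℝ :=
  ζ.comp (fun a => ‖a‖) continuous_norm

/-- The inclusion `L⁰(F, ℝ) ⊆ L⁰(F, 𝕜)`. -/
def ofRealL0 (𝕜 : Type*) [RCLike 𝕜] (η : Ω →ₘ[P] ℝ) : Ω →ₘ[P] 𝕜 :=
  η.comp (fun r : ℝ => (r : 𝕜)) RCLike.continuous_ofReal

/-- The random variable `e ^ (ξ s)`. -/
def expL0 (ξ : Ω →ₘ[P] ℝ) (s : ℝ) : Ω →ₘ[P] ℝ :=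
  ξ.comp (fun r : ℝ => Real.exp (r * s)) (by fun_prop)

/-- `G_ξ`: the set of all `η ∈ L⁰(F, ℝ)` with `η > ξ` on `Ω`, i.e. almost surely. -/
def strictAbove (ξ : Ω →ₘ[P] ℝ) : Set (Ω →ₘ[P] ℝ) :=
  {η | ∀ᵐ ω ∂P, ξ ω < η ω}

/-- The filter on `L⁰(F, ℝ)` of the convergence `η → ∞` in probability. A set belongs to it iff
it contains `{η | P[η > N] > 1 - δ}` for some real `N` and some `δ > 0`. -/
def atInfinity (P : Measure Ω) : Filter (Ω →ₘ[P] ℝ) :=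
  ⨅ (N : ℝ) (δ : ℝ) (_ : 0 < δ), 𝓟 {η | 1 - δ < P.real {ω | N < η ω}}

end L0

/-! ### Random normed modules -/

/-- An `L⁰`-norm on a module `S` over the algebra `L⁰(F, 𝕜)`. The pair of `S` and such a norm is a
random normed module over `𝕜` with base `(Ω, F, P)`. -/
structure L0Norm {Ω : Type*} [MeasurableSpace Ω] (P : Measure Ω) (𝕜 : Type*) [RCLike 𝕜]
    (S : Type*) [AddCommGroup S] [Module (Ω →ₘ[P] 𝕜) S] where
  toFun : S → (Ω →ₘ[P] ℝ)
  nonneg' : ∀ x, 0 ≤ toFun x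
  eq_zero' : ∀ x, toFun x = 0 → x = 0
  smul' : ∀ (ζ : Ω →ₘ[P] 𝕜) (x : S), toFun (ζ • x) = absL0 ζ * toFun x
  add_le' : ∀ x y, toFun (x + y) ≤ toFun x + toFun y

namespace L0Norm

variable {Ω : Type*} [MeasurableSpace Ω] {P : Measure Ω} {𝕜 : Type*} [RCLike 𝕜]
  {S : Type*} [AddCommGroup S] [Module (Ω →ₘ[P] 𝕜) S]

instance : CoeFun (L0Norm P 𝕜 S) (fun _ => S → (Ω →ₘ[P] ℝ)) := ⟨L0Norm.toFun⟩

/-- The set `U_θ(ε, δ)` of all `z` with `P[‖z‖ < ε] > 1 - δ`. -/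
def zeroNhd (N : L0Norm P 𝕜 S) (ε δ : ℝ) : Set S :=
  {z | 1 - δ < P.real {ω | N z ω < ε}}

theorem map_zero (N : L0Norm P 𝕜 S) : N 0 = 0 := by
  have h := N.smul' 0 0
  have h0 : absL0 (0 : Ω →ₘ[P] 𝕜) = 0 := by
    refine AEEqFun.ext ?_
    filter_upwards [AEEqFun.coeFn_comp (fun a : 𝕜 => ‖a‖) continuous_norm (0 : Ω →ₘ[P] 𝕜),
      AEEqFun.coeFn_zero (μ := P) (β := 𝕜) (α := Ω),
      AEEqFun.coeFn_zero (μ := P) (β := ℝ) (α := Ω)] with ω h1 h2 h3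
    rw [absL0, h1, h3]
    simp [h2]
  rwa [smul_zero, h0, zero_mul] at h

theorem map_neg (N : L0Norm P 𝕜 S) (x : S) : N (-x) = N x := by
  have h := N.smul' (-1) x
  have h0 : absL0 (-1 : Ω →ₘ[P] 𝕜) = 1 := by
    refine AEEqFun.ext ?_
    filter_upwards [AEEqFun.coeFn_comp (fun a : 𝕜 => ‖a‖) continuous_norm (-1 : Ω →ₘ[P] 𝕜),
      AEEqFun.coeFn_neg (1 : Ω →ₘ[P] 𝕜),
      AEEqFun.coeFn_one (μ := P) (β := 𝕜) (α := Ω),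
      AEEqFun.coeFn_one (μ := P) (β := ℝ) (α := Ω)] with ω h1 h2 h3 h4
    rw [absL0, h1, h4]
    simp [h2, h3]
  rwa [neg_smul, one_smul, h0, one_mul] at h

variable [IsProbabilityMeasure P]

theorem mem_zeroNhd_iff (N : L0Norm P 𝕜 S) {ε δ : ℝ} {z : S} :
    z ∈ N.zeroNhd ε δ ↔ P.real {ω | ε ≤ N z ω} < δ := by
  have hm : MeasurableSet {ω | N z ω < ε} :=
    measurableSet_lt (N z).measurable measurable_const
  have hc : {ω | ε ≤ N z ω} = {ω | N z ω < ε}ᶜ := by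
    ext ω; simp
  rw [hc, probReal_compl_eq_one_sub hm]
  change 1 - δ < P.real {ω | N z ω < ε} ↔ _
  constructor <;> intro h <;> linarith

theorem zeroNhd_mono (N : L0Norm P 𝕜 S) {ε ε' δ δ' : ℝ} (hε : ε ≤ ε') (hδ : δ ≤ δ') :
    N.zeroNhd ε δ ⊆ N.zeroNhd ε' δ' := by
  intro z hz
  rw [mem_zeroNhd_iff] at hz ⊢
  refine lt_of_le_of_lt (measureReal_mono ?_) (hz.trans_le hδ)
  intro ω hω
  exact hε.trans hω

/-- The sets `U_θ(ε, δ)`, `ε > 0`, `0 < δ < 1`, form a basis of neighbourhoods of zero for a group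
topology. -/
@[reducible]
def filterBasis (N : L0Norm P 𝕜 S) : AddGroupFilterBasis S :=
  addGroupFilterBasisOfComm {U | ∃ ε δ : ℝ, 0 < ε ∧ 0 < δ ∧ δ < 1 ∧ U = N.zeroNhd ε δ}
    ⟨_, 1, 1 / 2, by norm_num, by norm_num, by norm_num, rfl⟩
    (by
      rintro _ _ ⟨ε, δ, hε, hδ, hδ1, rfl⟩ ⟨ε', δ', hε', hδ', hδ1', rfl⟩
      exact ⟨_, ⟨min ε ε', min δ δ', lt_min hε hε', lt_min hδ hδ', (min_le_left _ _).trans_lt hδ1,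
        rfl⟩, Set.subset_inter (N.zeroNhd_mono (min_le_left _ _) (min_le_left _ _))
          (N.zeroNhd_mono (min_le_right _ _) (min_le_right _ _))⟩)
    (by
      rintro _ ⟨ε, δ, hε, hδ, hδ1, rfl⟩
      rw [mem_zeroNhd_iff, N.map_zero]
      have : P.real {ω | ε ≤ (0 : Ω →ₘ[P] ℝ) ω} = 0 := by
        have h : P {ω | ε ≤ (0 : Ω →ₘ[P] ℝ) ω} = 0 := by
          have h' : ∀ᵐ ω ∂P, ¬ ε ≤ (0 : Ω →ₘ[P] ℝ) ω := by
            filter_upwards [AEEqFun.coeFn_zero (μ := P) (β := ℝ) (α := Ω)] with ω hω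
            simp [hω, hε]
          simpa [ae_iff] using h'
        rw [measureReal_def, h, ENNReal.toReal_zero]
      rw [this]
      exact hδ)
    (by
      rintro _ ⟨ε, δ, hε, hδ, hδ1, rfl⟩
      refine ⟨_, ⟨ε / 2, δ / 2, by linarith, by linarith, by linarith, rfl⟩, ?_⟩
      rintro _ ⟨x, hx, y, hy, rfl⟩
      rw [mem_zeroNhd_iff] at hx hy ⊢
      have hle : P.real {ω | ε ≤ N (x + y) ω} ≤
          P.real ({ω | ε / 2 ≤ N x ω} ∪ {ω | ε / 2 ≤ N y ω}) := by
        refine ENNReal.toReal_mono (measure_ne_top _ _) (measure_mono_ae ?_)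
        filter_upwards [AEEqFun.coeFn_le.2 (N.add_le' x y), AEEqFun.coeFn_add (N x) (N y)] with ω h1 h2 h3
        rw [h2] at h1
        have h3' : ε ≤ N (x + y) ω := h3
        have h1' : N (x + y) ω ≤ N x ω + N y ω := h1
        by_contra hcon
        have hcon' : ¬ (ε / 2 ≤ N x ω ∨ ε / 2 ≤ N y ω) := hcon
        push Not at hcon'
        linarith [hcon'.1, hcon'.2]
      linarith [measureReal_union_le (μ := P) {ω | ε / 2 ≤ N x ω} {ω | ε / 2 ≤ N y ω}])
    (by
      rintro _ ⟨ε, δ, hε, hδ, hδ1, rfl⟩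
      refine ⟨_, ⟨ε, δ, hε, hδ, hδ1, rfl⟩, fun z hz => ?_⟩
      change 1 - δ < P.real {ω | N (-z) ω < ε}
      rw [N.map_neg]
      exact hz)

/-- The `(ε, λ)`-topology. -/
@[reducible]
def topology (N : L0Norm P 𝕜 S) : TopologicalSpace S := N.filterBasis.topology

/-- Completeness for the `(ε, λ)`-topology, i.e. for the uniformity of this group topology. -/
def IsComplete (N : L0Norm P 𝕜 S) : Prop :=
  @CompleteSpace S N.filterBasis.uniformSpace

end L0Norm

/-! ### Almost surely bounded operators, `C`-semigroups and their generators -/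

section Operators

variable {Ω : Type*} [MeasurableSpace Ω] {P : Measure Ω} {𝕜 : Type*} [RCLike 𝕜]
  {S : Type*} [AddCommGroup S] [Module (Ω →ₘ[P] 𝕜) S] [Module 𝕜 S]

/-- The set of all `η ∈ L⁰₊(F)` with `‖T z‖ ≤ η ‖z‖` for all `z`. -/
def boundSet (N : L0Norm P 𝕜 S) (T : S →ₗ[𝕜] S) : Set (Ω →ₘ[P] ℝ) :=
  {η | 0 ≤ η ∧ ∀ z, N (T z) ≤ η * N z}

/-- `T ∈ B(S)`: the linear operator `T` is almost surely bounded. -/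
def IsASBounded (N : L0Norm P 𝕜 S) (T : S →ₗ[𝕜] S) : Prop :=
  (boundSet N T).Nonempty

/-- `g = ‖T‖`, the infimum in `L⁰(F, ℝ)` of all almost sure bounds of `T`. -/
def IsOpNorm (N : L0Norm P 𝕜 S) (T : S →ₗ[𝕜] S) (g : Ω →ₘ[P] ℝ) : Prop :=
  IsGLB (boundSet N T) g

variable [IsProbabilityMeasure P]

/-- `{W(s) : s ≥ 0} ⊆ B(S)` is a `C`-semigroup, where `C ∈ B(S)` is injective. -/
structure IsCSemigroup (N : L0Norm P 𝕜 S) (C : S →ₗ[𝕜] S) (W : ℝ≥0 → (S →ₗ[𝕜] S)) : Prop where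
  bounded_C : IsASBounded N C
  injective_C : Function.Injective C
  bounded : ∀ s, IsASBounded N (W s)
  mul : ∀ s t x, C (W (s + t) x) = W t (W s x)
  zero : W 0 = C
  continuous : ∀ x, @Continuous ℝ≥0 S _ N.topology (fun s => W s x)

/-- The class `H(M, ξ)` of the `C`-semigroups with `‖W(s)‖ ≤ M e ^ (ξ s)` for all `s ≥ 0`. -/
structure IsExpBounded (N : L0Norm P 𝕜 S) (C : S →ₗ[𝕜] S) (M ξ : Ω →ₘ[P] ℝ)
    (W : ℝ≥0 → (S →ₗ[𝕜] S)) : Prop extends IsCSemigroup N C W where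
  norm_le : ∀ s : ℝ≥0, ∃ g, IsOpNorm N (W s) g ∧ g ≤ M * expL0 ξ s

/-- `C y = lim_{s → 0+} (W(s) x - C x) / s` in the `(ε, λ)`-topology. -/
def IsGeneratorValue (N : L0Norm P 𝕜 S) (C : S →ₗ[𝕜] S) (W : ℝ≥0 → (S →ₗ[𝕜] S)) (x y : S) : Prop :=
  Tendsto (fun s : ℝ≥0 => (((s : ℝ)⁻¹ : ℝ) : 𝕜) • (W s x - C x)) (𝓝[>] 0)
    (@nhds S N.topology (C y))

/-- The domain `D(A)` of the infinitesimal generator: the limit of `(W(s) x - C x) / s` exists and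
lies in the range of `C`. -/
def generatorDomain (N : L0Norm P 𝕜 S) (C : S →ₗ[𝕜] S) (W : ℝ≥0 → (S →ₗ[𝕜] S)) : Set S :=
  {x | ∃ y, IsGeneratorValue N C W x y}

/-- The infinitesimal generator `A : D(A) → S`, `A x = C⁻¹ lim_{s → 0+} (W(s) x - C x) / s`. -/
def generator (N : L0Norm P 𝕜 S) (C : S →ₗ[𝕜] S) (W : ℝ≥0 → (S →ₗ[𝕜] S))
    (x : generatorDomain N C W) : S :=
  Classical.choose x.2

end Operators

/-! ### The `C`-resolvent of an operator `A : D → S` -/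

section Resolvent

variable {Ω : Type*} [MeasurableSpace Ω] {P : Measure Ω} {𝕜 : Type*} [RCLike 𝕜]
  {S : Type*} [AddCommGroup S] [Module (Ω →ₘ[P] 𝕜) S]

/-- The operator `η - A : D → S`. -/
def subOp {D : Set S} (A : D → S) (η : Ω →ₘ[P] 𝕜) (z : D) : S := η • (z : S) - A z

/-- The `C`-resolvent set `ρ_C(A)`: the `η ∈ L⁰(F, 𝕜)` such that `η - A` is injective and its range
contains the range of `C`. -/
def cResolventSet (C : S → S) {D : Set S} (A : D → S) : Set (Ω →ₘ[P] 𝕜) :=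
  {η | Function.Injective (subOp A η) ∧ Set.range C ⊆ Set.range (subOp A η)}

/-- The `C`-resolvent `R_C(η, A) = (η - A)⁻¹ C`, with values in the domain of `A`. -/
def cResolvent {C : S → S} {D : Set S} {A : D → S} {η : Ω →ₘ[P] 𝕜}
    (h : η ∈ cResolventSet C A) (x : S) : D :=
  Classical.choose (h.2 ⟨x, rfl⟩)

end Resolvent

end RandomNormed

end

/-! The `C`-resolvent is the Laplace transform of the semigroup: `R_η x = ∫_0^∞ e^{-ηt} W(t)x dt`.
Suppose it is known that `A R_η x = ηR_η x - Cx` on `S`, that `R_η A x = ηR_η x - Cx` on `D(A)`, and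
that `‖R_η‖ ≤ M/(η-ξ)` (`IsExpBounded.exists_resolvent`). The rest is then algebra and an
approximation argument. If `(η-A)z = 0`, the second identity gives `Cz = 0`, so `z = 0`; the first
gives `(η-A)R_η = C`. Together they give `A R_η = R_η A` on `D(A)`, so (b) is (a) at the vector
`Ax`. For (a), `ηR_η x - Cx = R_η Ax` tends to zero on `D(A)`, and `‖ηR_η‖ ≤ 2M` where `η ≥ 2|ξ|`,
so the limit passes to the closure of `D(A)`. That closure is `S`, because it contains the dense
range of `C²` (`IsExpBounded.dense_generatorDomain`).

The work lies in the integral: `S` need not be locally convex, and all growth rates are random. Two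
devices handle this. First, almost surely bounded `𝕜`-linear operators are automatically `L⁰`-linear
(`BoundedBy.map_smul`), so random multipliers such as `e^{-ηt}` pass through them. Second, the
elements with integrable norm form a Banach space (`completeSpace_integrable`). A strictly positive
random weight moves a decaying orbit into it; the orbit is integrated there and the weight divided
out. Almost sure bounds on the integral come back from bounds in mean by localising to measurable
sets (`IsHalfLineIntegral.norm_le`). -/

namespace RandomNormed

/-! ### Real random variables as scalars -/

section Multipliers

variable {Ω : Type*} [MeasurableSpace Ω] {P : Measure Ω} {𝕜 : Type*} [RCLike 𝕜]

/-- The class in `L⁰(F, 𝕜)` of a real random variable. -/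
noncomputable def rv (P : Measure Ω) (𝕜 : Type*) [RCLike 𝕜] (g : Ω → ℝ) (hg : Measurable g) :
    Ω →ₘ[P] 𝕜 :=
  AEEqFun.mk (fun ω => (g ω : 𝕜)) (RCLike.measurable_ofReal.comp hg).aestronglyMeasurable

theorem coeFn_rv {g : Ω → ℝ} (hg : Measurable g) :
    ∀ᵐ ω ∂P, rv P 𝕜 g hg ω = (g ω : 𝕜) :=
  AEEqFun.coeFn_mk _ _

theorem coeFn_absL0 (ζ : Ω →ₘ[P] 𝕜) : ∀ᵐ ω ∂P, absL0 ζ ω = ‖ζ ω‖ :=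
  AEEqFun.coeFn_comp _ continuous_norm ζ

theorem ofRealL0_eq_rv (η : Ω →ₘ[P] ℝ) : ofRealL0 𝕜 η = rv P 𝕜 η η.measurable := by
  refine AEEqFun.ext ?_
  filter_upwards [AEEqFun.coeFn_comp (fun r : ℝ => (r : 𝕜)) RCLike.continuous_ofReal η,
    coeFn_rv (P := P) (𝕜 := 𝕜) η.measurable] with ω h1 h2
  rw [h2, ofRealL0, h1, Function.comp]

theorem coeFn_expL0 (ξ : Ω →ₘ[P] ℝ) (s : ℝ) : ∀ᵐ ω ∂P, expL0 ξ s ω = Real.exp (ξ ω * s) :=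
  AEEqFun.coeFn_comp _ _ ξ

theorem rv_mul {g h : Ω → ℝ} (hg : Measurable g) (hh : Measurable h) :
    rv P 𝕜 g hg * rv P 𝕜 h hh = rv P 𝕜 (fun ω => g ω * h ω) (hg.mul hh) := by
  refine AEEqFun.ext ?_
  filter_upwards [AEEqFun.coeFn_mul (rv P 𝕜 g hg) (rv P 𝕜 h hh), coeFn_rv (P := P) (𝕜 := 𝕜) hg,
    coeFn_rv (P := P) (𝕜 := 𝕜) hh, coeFn_rv (P := P) (𝕜 := 𝕜) (g := fun ω => g ω * h ω) (hg.mul hh)] with ω h1 h2 h3 h4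
  rw [h1, h4, Pi.mul_apply, h2, h3]
  exact (RCLike.ofReal_mul _ _).symm

theorem rv_congr {g h : Ω → ℝ} (hg : Measurable g) (hh : Measurable h)
    (hgh : ∀ᵐ ω ∂P, g ω = h ω) : rv P 𝕜 g hg = rv P 𝕜 h hh := by
  refine AEEqFun.ext ?_
  filter_upwards [hgh, coeFn_rv (P := P) (𝕜 := 𝕜) hg, coeFn_rv (P := P) (𝕜 := 𝕜) hh]
    with ω h1 h2 h3
  rw [h2, h3, h1]

theorem rv_one : rv P 𝕜 (fun _ => 1) measurable_const = 1 := by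
  refine AEEqFun.ext ?_
  filter_upwards [AEEqFun.coeFn_one (α := Ω) (μ := P) (β := 𝕜),
    coeFn_rv (P := P) (𝕜 := 𝕜) (g := fun _ => 1) measurable_const] with ω h1 h2
  rw [h2, h1]
  simp

end Multipliers

/-! ### Almost sure forms of the norm axioms -/

namespace L0Norm

variable {Ω : Type*} [MeasurableSpace Ω] {P : Measure Ω} {𝕜 : Type*} [RCLike 𝕜]
  {S : Type*} [AddCommGroup S] [Module (Ω →ₘ[P] 𝕜) S]

theorem nonneg_ae (N : L0Norm P 𝕜 S) (x : S) : ∀ᵐ ω ∂P, 0 ≤ N x ω := by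
  filter_upwards [AEEqFun.coeFn_le.2 (N.nonneg' x), AEEqFun.coeFn_zero (μ := P) (β := ℝ) (α := Ω)]
    with ω h1 h2
  rw [h2] at h1
  exact h1

theorem add_le_ae (N : L0Norm P 𝕜 S) (x y : S) : ∀ᵐ ω ∂P, N (x + y) ω ≤ N x ω + N y ω := by
  filter_upwards [AEEqFun.coeFn_le.2 (N.add_le' x y), AEEqFun.coeFn_add (N x) (N y)] with ω h1 h2
  rw [h2] at h1
  exact h1

theorem sub_le_ae (N : L0Norm P 𝕜 S) (x y : S) : ∀ᵐ ω ∂P, N (x - y) ω ≤ N x ω + N y ω := by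
  have := N.add_le_ae x (-y)
  rwa [N.map_neg, ← sub_eq_add_neg] at this

theorem map_sub_rev (N : L0Norm P 𝕜 S) (x y : S) : N (x - y) = N (y - x) := by
  rw [← N.map_neg, neg_sub]

theorem zero_ae (N : L0Norm P 𝕜 S) : ∀ᵐ ω ∂P, N 0 ω = 0 := by
  rw [N.map_zero]
  exact AEEqFun.coeFn_zero

theorem smul_ae (N : L0Norm P 𝕜 S) (ζ : Ω →ₘ[P] 𝕜) (x : S) :
    ∀ᵐ ω ∂P, N (ζ • x) ω = ‖ζ ω‖ * N x ω := by
  rw [N.smul']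
  filter_upwards [AEEqFun.coeFn_mul (absL0 ζ) (N x), coeFn_absL0 ζ] with ω h1 h2
  rw [h1, Pi.mul_apply, h2]

theorem rv_smul_ae (N : L0Norm P 𝕜 S) {g : Ω → ℝ} (hg : Measurable g) (x : S) :
    ∀ᵐ ω ∂P, N (rv P 𝕜 g hg • x) ω = |g ω| * N x ω := by
  filter_upwards [N.smul_ae (rv P 𝕜 g hg) x, coeFn_rv (P := P) (𝕜 := 𝕜) hg] with ω h1 h2
  rw [h1, h2, RCLike.norm_ofReal]

theorem csmul_ae [Module 𝕜 S] [IsScalarTower 𝕜 (Ω →ₘ[P] 𝕜) S] (N : L0Norm P 𝕜 S) (c : 𝕜) (x : S) :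
    ∀ᵐ ω ∂P, N (c • x) ω = ‖c‖ * N x ω := by
  have h : c • x = (c • (1 : Ω →ₘ[P] 𝕜)) • x := by rw [smul_assoc, one_smul]
  rw [h]
  filter_upwards [N.smul_ae (c • (1 : Ω →ₘ[P] 𝕜)) x, AEEqFun.coeFn_smul c (1 : Ω →ₘ[P] 𝕜),
    AEEqFun.coeFn_one (α := Ω) (μ := P) (β := 𝕜)] with ω h1 h2 h3
  rw [h1, h2, Pi.smul_apply, h3]
  simp

theorem eq_zero_of_ae (N : L0Norm P 𝕜 S) {x : S} (h : ∀ᵐ ω ∂P, N x ω ≤ 0) : x = 0 := by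
  refine N.eq_zero' x (AEEqFun.ext ?_)
  filter_upwards [h, N.nonneg_ae x, AEEqFun.coeFn_zero (μ := P) (β := ℝ) (α := Ω)] with ω h1 h2 h3
  rw [h3]
  exact le_antisymm h1 h2

theorem eq_of_ae (N : L0Norm P 𝕜 S) {x y : S} (h : ∀ᵐ ω ∂P, N (x - y) ω ≤ 0) : x = y :=
  sub_eq_zero.1 (N.eq_zero_of_ae h)

end L0Norm

/-! ### Convergence in probability and the `(ε, λ)`-topology -/

section TendstoZero

variable {Ω : Type*} [MeasurableSpace Ω] {ι : Type*}

/-- The positive parts of the functions `q a` tend to zero in probability along `l`. -/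
def TendstoZero (P : Measure Ω) (l : Filter ι) (q : ι → Ω → ℝ) : Prop :=
  ∀ ε > 0, ∀ δ > 0, ∀ᶠ a in l, P.real {ω | ε ≤ q a ω} < δ

variable {P : Measure Ω} [IsProbabilityMeasure P] {l : Filter ι} {q q' : ι → Ω → ℝ}

theorem measureReal_le_of_ae {s t : Set Ω} (h : ∀ᵐ ω ∂P, ω ∈ s → ω ∈ t) : P.real s ≤ P.real t :=
  ENNReal.toReal_mono (measure_ne_top _ _) (measure_mono_ae h)

namespace TendstoZero

theorem mono (h : TendstoZero P l q) (hq : ∀ᶠ a in l, ∀ᵐ ω ∂P, q' a ω ≤ q a ω) :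
    TendstoZero P l q' := by
  intro ε hε δ hδ
  filter_upwards [h ε hε δ hδ, hq] with a h1 h2
  refine (measureReal_le_of_ae ?_).trans_lt h1
  filter_upwards [h2] with ω h3 h4
  exact le_trans h4 h3

theorem add (h : TendstoZero P l q) (h' : TendstoZero P l q') :
    TendstoZero P l (fun a ω => q a ω + q' a ω) := by
  intro ε hε δ hδ
  filter_upwards [h (ε / 2) (by linarith) (δ / 2) (by linarith),
    h' (ε / 2) (by linarith) (δ / 2) (by linarith)] with a h1 h2
  have h3 : P.real {ω | ε ≤ q a ω + q' a ω} ≤ P.real ({ω | ε / 2 ≤ q a ω} ∪ {ω | ε / 2 ≤ q' a ω}) := by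
    refine measureReal_mono ?_
    intro ω (hω : ε ≤ q a ω + q' a ω)
    by_contra hcon
    have hcon' : ¬ (ε / 2 ≤ q a ω ∨ ε / 2 ≤ q' a ω) := hcon
    push Not at hcon'
    linarith [hcon'.1, hcon'.2]
  linarith [measureReal_union_le (μ := P) {ω | ε / 2 ≤ q a ω} {ω | ε / 2 ≤ q' a ω}]

/-- Tightness of a single random variable: the sets `{n ≤ K}` decrease to the empty set because `K`
is finite everywhere. -/
theorem exists_measureReal_lt (K : Ω → ℝ) (hK : Measurable K) {δ : ℝ} (hδ : 0 < δ) :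
    ∃ n : ℝ, 0 < n ∧ P.real {ω | n ≤ K ω} < δ := by
  have h1 : Tendsto (fun n : ℕ => P {ω | (n : ℝ) ≤ K ω}) atTop (𝓝 (P (⋂ n : ℕ, {ω | (n : ℝ) ≤ K ω}))) := by
    refine tendsto_measure_iInter_atTop (fun n => ?_) ?_ ⟨0, measure_ne_top _ _⟩
    · exact (measurableSet_le measurable_const hK).nullMeasurableSet
    · intro m n hmn ω (hω : (n : ℝ) ≤ K ω)
      exact (Nat.cast_le.2 hmn).trans hω
  have h2 : (⋂ n : ℕ, {ω | (n : ℝ) ≤ K ω}) = ∅ := by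
    ext ω
    simp only [Set.mem_iInter, Set.mem_ofPred_eq, Set.mem_empty_iff_false, iff_false, not_forall,
      not_le]
    exact exists_nat_gt (K ω)
  rw [h2, measure_empty] at h1
  have h3 := (ENNReal.tendsto_toReal ENNReal.zero_ne_top).comp h1
  rw [ENNReal.toReal_zero] at h3
  obtain ⟨n, hn, hn'⟩ := ((h3.eventually (gt_mem_nhds hδ)).and (eventually_gt_atTop 0)).exists
  exact ⟨n, by exact_mod_cast hn', hn⟩

/-- The factor `K` need not be bounded: by tightness it lies below a constant `n` off an event of
probability `δ/2`, and there `q < ε/n` suffices. This makes almost surely bounded operators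
continuous. -/
theorem mul_left (h : TendstoZero P l q) (K : Ω → ℝ) (hK : Measurable K)
    (hK0 : ∀ᵐ ω ∂P, 0 ≤ K ω) : TendstoZero P l (fun a ω => K ω * q a ω) := by
  intro ε hε δ hδ
  obtain ⟨n, hn, hnK⟩ := exists_measureReal_lt (P := P) K hK (half_pos hδ)
  filter_upwards [h (ε / n) (by positivity) (δ / 2) (by linarith)] with a h1
  have h3 : P.real {ω | ε ≤ K ω * q a ω} ≤ P.real ({ω | n ≤ K ω} ∪ {ω | ε / n ≤ q a ω}) := by
    refine measureReal_le_of_ae ?_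
    filter_upwards [hK0] with ω h0 (hω : ε ≤ K ω * q a ω)
    by_contra hcon
    have hcon' : ¬ (n ≤ K ω ∨ ε / n ≤ q a ω) := hcon
    push Not at hcon'
    obtain ⟨hc1, hc2⟩ := hcon'
    rw [lt_div_iff₀ hn] at hc2
    rcases le_or_gt (q a ω) 0 with h | h
    · nlinarith
    · nlinarith
  linarith [measureReal_union_le (μ := P) {ω | n ≤ K ω} {ω | ε / n ≤ q a ω}]

omit [IsProbabilityMeasure P] in
theorem of_tendsto {c : ι → ℝ} (h : Tendsto c l (𝓝 0)) : TendstoZero P l (fun a _ => c a) := by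
  intro ε hε δ hδ
  filter_upwards [h.eventually (gt_mem_nhds hε)] with a ha
  have : {ω : Ω | ε ≤ c a} = ∅ := by
    ext ω
    simpa using ha
  rw [this]
  simpa using hδ

end TendstoZero

variable {𝕜 : Type*} [RCLike 𝕜] {S : Type*} [AddCommGroup S] [Module (Ω →ₘ[P] 𝕜) S]

namespace L0Norm

theorem hasBasis_nhds (N : L0Norm P 𝕜 S) (x : S) :
    (@nhds S N.topology x).HasBasis (fun p : ℝ × ℝ => 0 < p.1 ∧ 0 < p.2)
      (fun p => {y | y - x ∈ N.zeroNhd p.1 p.2}) := by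
  refine (N.filterBasis.nhds_hasBasis x).to_hasBasis ?_ ?_
  · rintro _ ⟨ε, δ, hε, hδ, -, rfl⟩
    exact ⟨(ε, δ), ⟨hε, hδ⟩, fun y hy => ⟨y - x, hy, by simp⟩⟩
  · rintro ⟨ε, δ⟩ ⟨hε, hδ⟩
    -- The defining basis only admits `δ < 1`; the cap at `1/2` lifts this restriction.
    refine ⟨_, ⟨ε, min δ (1 / 2), hε, lt_min hδ (by norm_num),
      (min_le_right _ _).trans_lt (by norm_num), rfl⟩, ?_⟩
    rintro _ ⟨z, hz, rfl⟩
    simp only [Set.mem_ofPred_eq, add_sub_cancel_left]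
    exact N.zeroNhd_mono le_rfl (min_le_left _ _) hz

/-- This is the bridge by which all later topological statements become statements about convergence
in probability of norms. -/
theorem tendsto_iff (N : L0Norm P 𝕜 S) {z : ι → S} {x : S} :
    Tendsto z l (@nhds S N.topology x) ↔ TendstoZero P l (fun a => N (z a - x)) := by
  rw [(N.hasBasis_nhds x).tendsto_right_iff]
  simp only [Set.mem_ofPred_eq, mem_zeroNhd_iff, Prod.forall, and_imp, TendstoZero]
  exact ⟨fun h ε hε δ hδ => h ε δ hε hδ, fun h ε δ hε hδ => h ε hε δ hδ⟩

theorem eq_of_tendstoZero_const (N : L0Norm P 𝕜 S) [l.NeBot] {x : S}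
    (h : TendstoZero P l (fun _ : ι => N x)) : x = 0 := by
  refine N.eq_zero_of_ae ?_
  have h1 : ∀ n : ℕ, ∀ᵐ ω ∂P, N x ω < 1 / ((n : ℝ) + 1) := by
    intro n
    have h2 : P.real {ω | 1 / ((n : ℝ) + 1) ≤ N x ω} ≤ 0 := by
      refine le_of_forall_pos_le_add fun δ hδ => ?_
      obtain ⟨a, ha⟩ := (h (1 / ((n : ℝ) + 1)) (by positivity) δ hδ).exists
      linarith
    have h3 := le_antisymm h2 measureReal_nonneg
    rw [measureReal_eq_zero_iff] at h3
    rw [ae_iff]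
    simpa only [not_lt] using h3
  filter_upwards [ae_all_iff.2 h1] with ω hω
  exact ge_of_tendsto' tendsto_one_div_add_atTop_nhds_zero_nat fun n => (hω n).le

theorem tendsto_unique (N : L0Norm P 𝕜 S) [l.NeBot] {z : ι → S} {x y : S}
    (hx : Tendsto z l (@nhds S N.topology x)) (hy : Tendsto z l (@nhds S N.topology y)) :
    x = y := by
  rw [N.tendsto_iff] at hx hy
  refine (sub_eq_zero.1 (N.eq_of_tendstoZero_const (l := l) ((hx.add hy).mono ?_)))
  refine Eventually.of_forall fun a => ?_
  filter_upwards [N.sub_le_ae (z a - y) (z a - x)] with ω h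
  rw [show x - y = (z a - y) - (z a - x) by abel]
  linarith

theorem mem_closure_iff (N : L0Norm P 𝕜 S) {D : Set S} {x : S} :
    x ∈ @closure S N.topology D ↔
      ∀ ε > 0, ∀ δ > 0, ∃ y ∈ D, P.real {ω | ε ≤ N (x - y) ω} < δ := by
  let := N.topology
  rw [mem_closure_iff_nhds_basis (N.hasBasis_nhds x)]
  simp only [Set.mem_ofPred_eq, mem_zeroNhd_iff, Prod.forall, and_imp]
  constructor
  · intro h ε hε δ hδ
    obtain ⟨y, hy, hy'⟩ := h ε δ hε hδ
    exact ⟨y, hy, by rwa [N.map_sub_rev]⟩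
  · intro h ε δ hε hδ
    obtain ⟨y, hy, hy'⟩ := h ε hε δ hδ
    exact ⟨y, hy, by rwa [N.map_sub_rev]⟩

/-- Sequential completeness of a complete random normed module. -/
theorem exists_tendsto (N : L0Norm P 𝕜 S) (hS : N.IsComplete) {z : ℕ → S}
    (hz : ∀ ε > 0, ∀ δ > 0, ∃ n₀, ∀ m ≥ n₀, ∀ n ≥ n₀, P.real {ω | ε ≤ N (z m - z n) ω} < δ) :
    ∃ x, TendstoZero P atTop (fun n => N (z n - x)) := by
  have hc : @Cauchy S N.filterBasis.uniformSpace (map z atTop) := by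
    rw [AddGroupFilterBasis.cauchy_iff]
    refine ⟨inferInstance, ?_⟩
    rintro _ ⟨ε, δ, hε, hδ, -, rfl⟩
    obtain ⟨n₀, hn₀⟩ := hz ε hε δ hδ
    refine ⟨z '' Set.Ici n₀, image_mem_map (Ici_mem_atTop n₀), ?_⟩
    rintro _ ⟨m, hm, rfl⟩ _ ⟨n, hn, rfl⟩
    rw [mem_zeroNhd_iff]
    exact hn₀ n hn m hm
  obtain ⟨x, hx⟩ := @CompleteSpace.complete S N.filterBasis.uniformSpace hS _ hc
  exact ⟨x, N.tendsto_iff.1 hx⟩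

end L0Norm

end TendstoZero

end RandomNormed

namespace RandomNormed

/-! ### Almost surely bounded operators and their `L⁰`-linearity -/

section BoundedOperators

variable {Ω : Type*} [MeasurableSpace Ω] {P : Measure Ω} {𝕜 : Type*} [RCLike 𝕜]
  {S : Type*} [AddCommGroup S] [Module (Ω →ₘ[P] 𝕜) S]

/-- The random variable `b ≥ 0` is an almost sure bound of `T`. -/
structure BoundedBy (N : L0Norm P 𝕜 S) (T : S → S) (b : Ω → ℝ) : Prop where
  measurable : Measurable b
  nonneg : ∀ᵐ ω ∂P, 0 ≤ b ω
  le : ∀ z, ∀ᵐ ω ∂P, N (T z) ω ≤ b ω * N z ω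

theorem boundedBy_of_mem_boundSet [Module 𝕜 S] {N : L0Norm P 𝕜 S} {T : S →ₗ[𝕜] S}
    {η : Ω →ₘ[P] ℝ} (h : η ∈ boundSet N T) : BoundedBy N T η where
  measurable := η.measurable
  nonneg := by
    filter_upwards [AEEqFun.coeFn_le.2 h.1, AEEqFun.coeFn_zero (μ := P) (β := ℝ) (α := Ω)]
      with ω h1 h2
    rw [h2] at h1
    exact h1
  le z := by
    filter_upwards [AEEqFun.coeFn_le.2 (h.2 z), AEEqFun.coeFn_mul η (N z)] with ω h1 h2
    rw [h2] at h1
    exact h1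

/-- The infimum of the almost sure bounds of `T` is an almost sure bound of `T`. -/
theorem IsOpNorm.boundedBy [Module 𝕜 S] {N : L0Norm P 𝕜 S} {T : S →ₗ[𝕜] S} {g : Ω →ₘ[P] ℝ}
    (hT : IsASBounded N T) (hg : IsOpNorm N T g) : BoundedBy N T g := by
  obtain ⟨η₀, hη₀⟩ := hT
  have hB₀ := boundedBy_of_mem_boundSet hη₀
  refine ⟨g.measurable, ?_, fun z => ?_⟩
  · have h0 : (0 : Ω →ₘ[P] ℝ) ≤ g := hg.2 fun η hη => hη.1
    filter_upwards [AEEqFun.coeFn_le.2 h0, AEEqFun.coeFn_zero (μ := P) (β := ℝ) (α := Ω)]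
      with ω h1 h2
    rw [h2] at h1
    exact h1
  -- For fixed `z` the quotient `‖Tz‖/‖z‖` is a lower bound of all almost sure bounds, hence lies
  -- below their infimum. The convention `a/0 = 0` keeps this true where `‖z‖` vanishes.
  · have hm : Measurable fun ω => N (T z) ω / N z ω :=
      (N (T z)).measurable.div (N z).measurable
    have hq : AEEqFun.mk _ hm.aestronglyMeasurable ≤ g := by
      refine hg.2 fun η hη => AEEqFun.coeFn_le.1 ?_
      have hB := boundedBy_of_mem_boundSet hη
      filter_upwards [AEEqFun.coeFn_mk _ (hm.aestronglyMeasurable (μ := P)), hB.nonneg, hB.le z,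
        N.nonneg_ae z] with ω h1 h2 h3 h4
      rw [h1]
      exact div_le_of_le_mul₀ h4 h2 h3
    filter_upwards [AEEqFun.coeFn_mk _ (hm.aestronglyMeasurable (μ := P)), AEEqFun.coeFn_le.2 hq,
      hB₀.le z, N.nonneg_ae z, N.nonneg_ae (T z)] with ω h1 h2 h3 h4 h5
    rw [h1] at h2
    -- Where `‖z‖ = 0` the quotient carries no information; there the known bound `η₀` forces `‖Tz‖
    -- = 0`.
    rcases h4.eq_or_lt with h | h
    · rw [← h] at h3 ⊢
      simpa using h3
    · rwa [div_le_iff₀ h] at h2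

section Linear

variable [Module 𝕜 S]

/-- Boundedness makes `T` local: `T(1_A x)` has norm at most `b 1_A ‖x‖`, so it vanishes off `A`,
and likewise for the complement. The commutator equals `1_{Aᶜ} T(1_A x) - 1_A T(1_{Aᶜ} x)`, and both
terms are zero. -/
theorem BoundedBy.map_indicator_smul {N : L0Norm P 𝕜 S} {T : S →ₗ[𝕜] S} {b : Ω → ℝ}
    (hT : BoundedBy N T b) {A : Set Ω} (hA : MeasurableSet A) (x : S) :
    T (rv P 𝕜 (A.indicator 1) (measurable_one.indicator hA) • x) =
      rv P 𝕜 (A.indicator 1) (measurable_one.indicator hA) • T x := by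
  have hm := (measurable_one (α := ℝ)).indicator hA
  have hm' := (measurable_one (α := ℝ)).indicator hA.compl
  set e := rv P 𝕜 (A.indicator 1) hm with he
  set e' := rv P 𝕜 (Aᶜ.indicator 1) hm' with he'
  have hee : e + e' = 1 := by
    refine AEEqFun.ext ?_
    filter_upwards [AEEqFun.coeFn_add e e', coeFn_rv (P := P) (𝕜 := 𝕜) hm,
      coeFn_rv (P := P) (𝕜 := 𝕜) hm', AEEqFun.coeFn_one (α := Ω) (μ := P) (β := 𝕜)]
      with ω h1 h2 h3 h4
    rw [h1, h4, Pi.add_apply, he, he', h2, h3]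
    by_cases h : ω ∈ A <;> simp [h]
  have hsplit : ∀ y : S, y = e • y + e' • y := fun y => by rw [← add_smul, hee, one_smul]
  have hdiff : T (e • x) - e • T x = e' • T (e • x) - e • T (e' • x) := by
    have h1 : T x = T (e • x) + T (e' • x) := by rw [← map_add, ← hsplit]
    have h2 := hsplit (T (e • x))
    rw [h1, smul_add]
    nth_rewrite 1 [h2]
    abel
  refine N.eq_of_ae ?_
  rw [hdiff]
  filter_upwards [N.sub_le_ae (e' • T (e • x)) (e • T (e' • x)), N.rv_smul_ae hm' (T (e • x)),
    N.rv_smul_ae hm (T (e' • x)), hT.le (e • x), hT.le (e' • x), N.rv_smul_ae hm x,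
    N.rv_smul_ae hm' x] with ω h1 h2 h3 h4 h5 h6 h7
  rw [h6] at h4
  rw [h7] at h5
  rw [h2, h3] at h1
  refine h1.trans ?_
  by_cases h : ω ∈ A
  · simp only [Set.indicator_of_mem h, Set.mem_compl_iff, h, not_true_eq_false,
      not_false_eq_true, Set.indicator_of_notMem, Pi.one_apply, abs_zero, abs_one] at h4 h5 ⊢
    linarith
  · simp only [Set.mem_compl_iff, h, not_false_eq_true, Set.indicator_of_notMem,
      Set.indicator_of_mem, Pi.one_apply, abs_zero, abs_one] at h4 h5 ⊢
    linarith

variable [IsScalarTower 𝕜 (Ω →ₘ[P] 𝕜) S]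

theorem BoundedBy.map_simpleFunc_smul {N : L0Norm P 𝕜 S} {T : S →ₗ[𝕜] S} {b : Ω → ℝ}
    (hT : BoundedBy N T b) (x : S) (f : SimpleFunc Ω 𝕜) :
    T ((AEEqFun.mk f f.aestronglyMeasurable : Ω →ₘ[P] 𝕜) • x) =
      (AEEqFun.mk f f.aestronglyMeasurable : Ω →ₘ[P] 𝕜) • T x := by
  induction f using SimpleFunc.induction with
  | @const c A hA =>
    have h : (AEEqFun.mk (SimpleFunc.piecewise A hA (SimpleFunc.const Ω c) (SimpleFunc.const Ω 0))
        (SimpleFunc.aestronglyMeasurable _) : Ω →ₘ[P] 𝕜) =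
        c • rv P 𝕜 (A.indicator 1) (measurable_one.indicator hA) := by
      refine AEEqFun.ext ?_
      filter_upwards [AEEqFun.coeFn_mk (μ := P)
        (SimpleFunc.piecewise A hA (SimpleFunc.const Ω c) (SimpleFunc.const Ω 0))
        (SimpleFunc.aestronglyMeasurable _),
        AEEqFun.coeFn_smul c (rv P 𝕜 (A.indicator 1) (measurable_one.indicator hA)),
        coeFn_rv (P := P) (𝕜 := 𝕜) ((measurable_one (α := ℝ)).indicator hA)] with ω h1 h2 h3
      rw [h1, h2, Pi.smul_apply, h3]
      by_cases h : ω ∈ A <;> simp [h]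
    rw [h, smul_assoc, map_smul, hT.map_indicator_smul hA, smul_assoc]
  | @add f g _ hf hg =>
    have h : (AEEqFun.mk ⇑(f + g) (f + g).aestronglyMeasurable : Ω →ₘ[P] 𝕜) =
        AEEqFun.mk f f.aestronglyMeasurable + AEEqFun.mk g g.aestronglyMeasurable := by
      rw [AEEqFun.mk_add_mk]
      rfl
    rw [h, add_smul, map_add, hf, hg, add_smul]

/-- An almost surely bounded `𝕜`-linear operator is `L⁰(F, 𝕜)`-linear. -/
theorem BoundedBy.map_smul {N : L0Norm P 𝕜 S} {T : S →ₗ[𝕜] S} {b : Ω → ℝ}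
    (hT : BoundedBy N T b) (ζ : Ω →ₘ[P] 𝕜) (x : S) : T (ζ • x) = ζ • T x := by
  let f : ℕ → SimpleFunc Ω 𝕜 := ζ.stronglyMeasurable.approx
  let F : ℕ → (Ω →ₘ[P] 𝕜) := fun n => AEEqFun.mk (f n) (f n).aestronglyMeasurable
  have hF : ∀ n, ∀ᵐ ω ∂P, F n ω = f n ω := fun n => AEEqFun.coeFn_mk _ _
  have hFζ : ∀ n, ∀ᵐ ω ∂P, (ζ - F n) ω = ζ ω - F n ω := fun n => AEEqFun.coeFn_sub _ _
  have hFζ' : ∀ n, ∀ᵐ ω ∂P, (F n - ζ) ω = F n ω - ζ ω := fun n => AEEqFun.coeFn_sub _ _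
  have hdiff : ∀ n, T (ζ • x) - ζ • T x = T ((ζ - F n) • x) + (F n - ζ) • T x := by
    intro n
    rw [sub_smul, sub_smul, map_sub, hT.map_simpleFunc_smul x (f n)]
    abel
  -- Only the error of the simple approximation depends on `n`; the factor in brackets is a fixed
  -- random variable. The approximants converge at every `ω`, so no topology on `S` is needed for
  -- the limit.
  have key : ∀ n, ∀ᵐ ω ∂P, N (T (ζ • x) - ζ • T x) ω ≤
      ‖f n ω - ζ ω‖ * (b ω * N x ω + N (T x) ω) := by
    intro n
    rw [hdiff n]
    filter_upwards [N.add_le_ae (T ((ζ - F n) • x)) ((F n - ζ) • T x), hT.le ((ζ - F n) • x),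
      N.smul_ae (ζ - F n) x, N.smul_ae (F n - ζ) (T x), hF n, hFζ n, hFζ' n]
      with ω h1 h2 h3 h4 h5 h6 h7
    rw [h4, h7, h5] at h1
    rw [h3, h6, h5, norm_sub_rev] at h2
    nlinarith
  refine N.eq_of_ae ?_
  filter_upwards [ae_all_iff.2 key] with ω hω
  have h1 : Tendsto (fun n => f n ω) atTop (𝓝 (ζ ω)) := ζ.stronglyMeasurable.tendsto_approx ω
  have h2 := ((tendsto_iff_norm_sub_tendsto_zero.1 h1).mul_const (b ω * N x ω + N (T x) ω))
  rw [zero_mul] at h2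
  exact ge_of_tendsto' h2 hω

/-- An almost surely bounded `𝕜`-linear operator as an `L⁰(F, 𝕜)`-linear map. -/
def BoundedBy.toLinearMap {N : L0Norm P 𝕜 S} {T : S →ₗ[𝕜] S} {b : Ω → ℝ}
    (hT : BoundedBy N T b) : S →ₗ[Ω →ₘ[P] 𝕜] S where
  toFun := T
  map_add' := T.map_add
  map_smul' := hT.map_smul

end Linear

section Continuity

variable {ι : Type*} {l : Filter ι}

theorem BoundedBy.tendsto [IsProbabilityMeasure P] {N : L0Norm P 𝕜 S} {T : S →ₗ[Ω →ₘ[P] 𝕜] S} {b : Ω → ℝ}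
    (hT : BoundedBy N T b) {z : ι → S} {x : S} (hz : Tendsto z l (@nhds S N.topology x)) :
    Tendsto (fun a => T (z a)) l (@nhds S N.topology (T x)) := by
  rw [N.tendsto_iff] at hz ⊢
  refine (hz.mul_left b hT.measurable hT.nonneg).mono (Eventually.of_forall fun a => ?_)
  rw [← map_sub]
  exact hT.le _

theorem boundedBy_lsmul (N : L0Norm P 𝕜 S) (ζ : Ω →ₘ[P] 𝕜) :
    BoundedBy N (LinearMap.lsmul (Ω →ₘ[P] 𝕜) S ζ) (fun ω => ‖ζ ω‖) :=
  ⟨ζ.measurable.norm, Eventually.of_forall fun _ => norm_nonneg _,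
    fun z => (N.smul_ae ζ z).mono fun _ h => h.le⟩

end Continuity

end BoundedOperators

end RandomNormed

namespace RandomNormed

/-! ### The Banach space of elements with integrable norm -/

section IntegrableElements

variable {Ω : Type*} [MeasurableSpace Ω] {P : Measure Ω} {𝕜 : Type*} [RCLike 𝕜]
  {S : Type*} [AddCommGroup S] [Module (Ω →ₘ[P] 𝕜) S] [Module 𝕜 S]
  [IsScalarTower 𝕜 (Ω →ₘ[P] 𝕜) S]

/-- The subspace of the elements with integrable norm. -/
def L0Norm.integrable (N : L0Norm P 𝕜 S) : Submodule 𝕜 S where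
  carrier := {z | Integrable (N z) P}
  zero_mem' := (integrable_zero Ω ℝ P).congr (by
    filter_upwards [N.zero_ae] with ω h using h.symm)
  add_mem' := by
    intro x y hx hy
    refine (Integrable.add hx hy).mono' (N _).aestronglyMeasurable ?_
    filter_upwards [N.add_le_ae x y, N.nonneg_ae (x + y)] with ω h1 h2
    rwa [Real.norm_of_nonneg h2]
  smul_mem' := by
    intro c x hx
    refine (Integrable.const_mul hx ‖c‖).congr ?_
    filter_upwards [N.csmul_ae c x] with ω h using h.symm

variable {N : L0Norm P 𝕜 S}

theorem integrable_of_le [IsFiniteMeasure P] {z : S} {K : ℝ} (h : ∀ᵐ ω ∂P, N z ω ≤ K) :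
    z ∈ N.integrable := by
  refine (integrable_const K).mono' (N z).aestronglyMeasurable ?_
  filter_upwards [h, N.nonneg_ae z] with ω h1 h2
  rwa [Real.norm_of_nonneg h2]

noncomputable instance : Norm N.integrable := ⟨fun z => ∫ ω, N (z : S) ω ∂P⟩

theorem integrable_norm_def (z : N.integrable) : ‖z‖ = ∫ ω, N (z : S) ω ∂P := rfl

theorem integrable_core : NormedSpace.Core 𝕜 N.integrable where
  norm_nonneg z := integral_nonneg_of_ae (N.nonneg_ae z)
  norm_smul c z := by
    rw [integrable_norm_def, integrable_norm_def, ← integral_const_mul]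
    exact integral_congr_ae (N.csmul_ae c z)
  norm_triangle x y := by
    rw [integrable_norm_def, integrable_norm_def, integrable_norm_def,
      ← integral_add x.2 y.2]
    exact integral_mono_ae (x + y).2 (Integrable.add x.2 y.2) (N.add_le_ae x y)
  norm_eq_zero_iff z := by
    rw [integrable_norm_def, integral_eq_zero_iff_of_nonneg_ae (N.nonneg_ae z) z.2]
    constructor
    · intro h
      exact Subtype.ext (N.eq_zero_of_ae (h.mono fun ω hω => hω.le))
    · rintro rfl
      exact N.zero_ae

noncomputable instance : NormedAddCommGroup N.integrable :=
  NormedAddCommGroup.ofCore (integrable_core (N := N))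

noncomputable instance : NormedSpace 𝕜 N.integrable :=
  NormedSpace.ofCore (integrable_core (N := N))

noncomputable instance : NormedSpace ℝ N.integrable :=
  NormedSpace.restrictScalars ℝ 𝕜 N.integrable

instance : IsScalarTower ℝ 𝕜 N.integrable where
  smul_assoc r c z := by
    change (r • c) • z = (algebraMap ℝ 𝕜 r) • (c • z)
    rw [Algebra.smul_def, mul_smul]

theorem coe_real_smul (r : ℝ) (z : N.integrable) : ((r • z : N.integrable) : S) = (r : 𝕜) • (z : S) :=
  rfl

omit [Module 𝕜 S] [IsScalarTower 𝕜 (Ω →ₘ[P] 𝕜) S] in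
theorem eLpNorm_one_eq (z : S) : eLpNorm (N z) 1 P = ∫⁻ ω, ENNReal.ofReal (N z ω) ∂P := by
  rw [eLpNorm_one_eq_lintegral_enorm]
  refine lintegral_congr_ae ?_
  filter_upwards [N.nonneg_ae z] with ω h
  rw [← Real.enorm_of_nonneg h]

theorem integrable_enorm_eq (z : N.integrable) :
    ‖z‖ₑ = ∫⁻ ω, ENNReal.ofReal (N (z : S) ω) ∂P := by
  rw [← ofReal_norm, integrable_norm_def,
    ofReal_integral_eq_lintegral_ofReal z.2 (N.nonneg_ae z)]

theorem mem_integrable_of_lintegral_lt_top {z : S}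
    (h : ∫⁻ ω, ENNReal.ofReal (N z ω) ∂P < ∞) : z ∈ N.integrable := by
  rw [← eLpNorm_one_eq] at h
  exact memLp_one_iff_integrable.1 ⟨(N z).aestronglyMeasurable, h⟩

variable {ι : Type*} {l : Filter ι}

theorem measureReal_le_norm_div [IsFiniteMeasure P] (z : N.integrable) {ε : ℝ} (hε : 0 < ε) :
    P.real {ω | ε ≤ N (z : S) ω} ≤ ‖z‖ / ε := by
  rw [le_div_iff₀ hε, mul_comm]
  exact mul_meas_ge_le_integral_of_nonneg (N.nonneg_ae z) z.2 ε

theorem tendstoZero_of_tendsto [IsFiniteMeasure P] {z : ι → N.integrable} {x : N.integrable}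
    (h : Tendsto z l (𝓝 x)) : TendstoZero P l (fun a => N ((z a : S) - x)) := by
  intro ε hε δ hδ
  have h1 := tendsto_iff_norm_sub_tendsto_zero.1 h
  filter_upwards [h1.eventually (gt_mem_nhds (mul_pos hδ hε))] with a ha
  refine (measureReal_le_norm_div (z a - x) hε).trans_lt ?_
  rwa [div_lt_iff₀ hε]

variable [IsProbabilityMeasure P]

theorem norm_le_of_le {z : N.integrable} {K : ℝ} (h : ∀ᵐ ω ∂P, N (z : S) ω ≤ K) : ‖z‖ ≤ K := by
  rw [integrable_norm_def]
  refine (integral_mono_ae z.2 (integrable_const K) h).trans ?_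
  simp

/-- On norm bounded sets, convergence in probability implies convergence in mean. -/
theorem tendsto_of_tendstoZero {z : ι → N.integrable} {x : N.integrable} {K : ℝ}
    (hK : ∀ᶠ a in l, ∀ᵐ ω ∂P, N ((z a : S) - x) ω ≤ K)
    (h : TendstoZero P l (fun a => N ((z a : S) - x))) : Tendsto z l (𝓝 x) := by
  rw [tendsto_iff_norm_sub_tendsto_zero, Metric.tendsto_nhds]
  intro ε hε
  -- `|K| + 1` replaces `K` so that the division below is legitimate for every real `K`.
  have hK' : 0 < |K| + 1 := by positivity
  filter_upwards [hK, h (ε / 2) (by linarith) (ε / (2 * (|K| + 1))) (by positivity)] with a h1 h2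
  rw [Real.dist_eq, sub_zero, abs_of_nonneg (norm_nonneg _), integrable_norm_def]
  have hm : MeasurableSet {ω | ε / 2 ≤ N ((z a : S) - x) ω} :=
    measurableSet_le measurable_const (N ((z a : S) - x)).measurable
  have h3 : ∫ ω, N ((z a : S) - x) ω ∂P ≤
      ∫ ω, (ε / 2 + {ω | ε / 2 ≤ N ((z a : S) - x) ω}.indicator (fun _ => |K|) ω) ∂P := by
    refine integral_mono_ae (z a - x).2
      ((integrable_const _).add ((integrable_const _).indicator hm)) ?_
    filter_upwards [h1] with ω hω
    by_cases hc : ω ∈ {ω | ε / 2 ≤ N ((z a : S) - x) ω}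
    · simp only [Set.indicator_of_mem hc]
      linarith [le_abs_self K]
    · simp only [Set.indicator_of_notMem hc]
      have : ¬ ε / 2 ≤ N ((z a : S) - x) ω := hc
      linarith
  refine h3.trans_lt ?_
  rw [integral_add (integrable_const _) ((integrable_const _).indicator hm),
    integral_indicator_const _ hm]
  simp only [integral_const, probReal_univ, smul_eq_mul, one_mul]
  have h4 : P.real {ω | ε / 2 ≤ N ((z a : S) - x) ω} * |K| ≤ ε / (2 * (|K| + 1)) * |K| :=
    mul_le_mul_of_nonneg_right h2.le (abs_nonneg K)
  have h5 : ε / (2 * (|K| + 1)) * |K| < ε / 2 := by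
    rw [div_mul_eq_mul_div, div_lt_div_iff₀ (by positivity) (by positivity)]
    nlinarith [abs_nonneg K]
  linarith

/-- By Markov's inequality a sequence that is Cauchy in mean is Cauchy in probability, so it has a
limit in `S`. Fatou's lemma for convergence in measure then shows that the limit has integrable norm
and that convergence holds in mean. -/
theorem completeSpace_integrable (hS : N.IsComplete) : CompleteSpace N.integrable := by
  refine Metric.complete_of_cauchySeq_tendsto fun z hz => ?_
  obtain ⟨x, hx⟩ := N.exists_tendsto hS (z := fun n => (z n : S)) (by
    intro ε hε δ hδ
    obtain ⟨n₀, hn₀⟩ := Metric.cauchySeq_iff.1 hz (δ * ε) (mul_pos hδ hε)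
    refine ⟨n₀, fun m hm n hn => (measureReal_le_norm_div (z m - z n) hε).trans_lt ?_⟩
    rw [div_lt_iff₀ hε, ← dist_eq_norm]
    exact hn₀ m hm n hn)
  have hle : ∀ n {C : ℝ}, (∀ᶠ m in atTop, ‖z n - z m‖ ≤ C) →
      ∫⁻ ω, ENNReal.ofReal (N ((z n : S) - x) ω) ∂P ≤ ENNReal.ofReal C := by
    intro n C hC
    rw [← eLpNorm_one_eq]
    refine eLpNorm_le_of_tendstoInMeasure (u := atTop) (f := fun m => N ((z n : S) - z m)) ?_ ?_
      (fun m => (N _).aestronglyMeasurable)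
    · filter_upwards [hC] with m hm
      rw [eLpNorm_one_eq]
      have := integrable_enorm_eq (z n - z m)
      rw [← ofReal_norm] at this
      exact this.symm.le.trans (ENNReal.ofReal_le_ofReal hm)
    · rw [tendstoInMeasure_iff_measureReal_norm]
      intro ε hε
      rw [Metric.tendsto_nhds]
      intro δ hδ
      filter_upwards [hx ε hε δ hδ] with m hm
      rw [Real.dist_eq, sub_zero, abs_of_nonneg measureReal_nonneg]
      refine (measureReal_le_of_ae ?_).trans_lt hm
      have e1 : ((z n : S) - z m) = ((z n : S) - x) - (z m - x) := by abel
      have e2 : ((z n : S) - x) = ((z n : S) - z m) + (z m - x) := by abel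
      have h1 := N.sub_le_ae ((z n : S) - x) (z m - x)
      have h2 := N.add_le_ae ((z n : S) - z m) (z m - x)
      rw [← e1] at h1
      rw [← e2] at h2
      filter_upwards [h1, h2] with ω h1 h2 h3
      refine le_trans (α := ℝ) h3 ?_
      rw [Real.norm_eq_abs, abs_le]
      constructor <;> linarith
  have hmem : ∃ n, (z n : S) - x ∈ N.integrable := by
    obtain ⟨n₀, hn₀⟩ := Metric.cauchySeq_iff.1 hz 1 one_pos
    refine ⟨n₀, mem_integrable_of_lintegral_lt_top ((hle n₀ (C := 1) ?_).trans_lt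
      ENNReal.ofReal_lt_top)⟩
    filter_upwards [eventually_ge_atTop n₀] with m hm
    rw [← dist_eq_norm]
    exact (hn₀ n₀ le_rfl m hm).le
  obtain ⟨n, hn⟩ := hmem
  have hxm : x ∈ N.integrable := by
    have := N.integrable.sub_mem (z n).2 hn
    rwa [sub_sub_cancel] at this
  refine ⟨⟨x, hxm⟩, ?_⟩
  rw [tendsto_iff_norm_sub_tendsto_zero, Metric.tendsto_nhds]
  intro ε hε
  obtain ⟨n₀, hn₀⟩ := Metric.cauchySeq_iff.1 hz (ε / 2) (by linarith)
  filter_upwards [eventually_ge_atTop n₀] with n hn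
  rw [Real.dist_eq, sub_zero, abs_of_nonneg (norm_nonneg _)]
  have h1 := hle n (C := ε / 2) (by
    filter_upwards [eventually_ge_atTop n₀] with m hm
    rw [← dist_eq_norm]
    exact (hn₀ n hn m hm).le)
  have h2 := integrable_enorm_eq (z n - ⟨x, hxm⟩)
  have h3 : ‖z n - ⟨x, hxm⟩‖ₑ ≤ ENNReal.ofReal (ε / 2) := h2.le.trans h1
  rw [← ofReal_norm, ENNReal.ofReal_le_ofReal_iff (by linarith)] at h3
  linarith

omit [IsProbabilityMeasure P] in
theorem map_csmul (T : S →ₗ[Ω →ₘ[P] 𝕜] S) (c : 𝕜) (x : S) : T (c • x) = c • T x := by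
  have h : ∀ y : S, c • y = (c • (1 : Ω →ₘ[P] 𝕜)) • y := fun y => by rw [smul_assoc, one_smul]
  rw [h, h, T.map_smul]

omit [IsProbabilityMeasure P] in
theorem mem_integrable_of_contraction {T : S →ₗ[Ω →ₘ[P] 𝕜] S}
    (hT : BoundedBy N T (fun _ => 1)) {z : S} (hz : z ∈ N.integrable) : T z ∈ N.integrable := by
  refine Integrable.mono' hz (N _).aestronglyMeasurable ?_
  filter_upwards [hT.le z, N.nonneg_ae (T z)] with ω h1 h2
  rwa [Real.norm_of_nonneg h2, ← one_mul (N z ω)]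

/-- The operator on the space of integrable elements induced by a contraction. -/
noncomputable def contractionCLM {T : S →ₗ[Ω →ₘ[P] 𝕜] S} (hT : BoundedBy N T (fun _ => 1)) :
    N.integrable →L[ℝ] N.integrable :=
  LinearMap.mkContinuous
    { toFun := fun z => ⟨T z, mem_integrable_of_contraction hT z.2⟩
      map_add' := fun x y => Subtype.ext (T.map_add x y)
      map_smul' := fun c x => Subtype.ext (map_csmul T _ _) } 1 (by
    intro z
    rw [one_mul]
    refine integral_mono_ae (mem_integrable_of_contraction hT z.2) z.2 ?_
    filter_upwards [hT.le z] with ω h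
    rwa [one_mul] at h)

omit [IsProbabilityMeasure P] in
theorem coe_contractionCLM {T : S →ₗ[Ω →ₘ[P] 𝕜] S} (hT : BoundedBy N T (fun _ => 1))
    (z : N.integrable) : (contractionCLM hT z : S) = T z := rfl

end IntegrableElements

end RandomNormed

/-! ### Strictly positive random weights -/

namespace RandomNormed

/-- A random variable with values in `(0, 1]`. -/
structure Weight (Ω : Type*) [MeasurableSpace Ω] where
  toFun : Ω → ℝ
  measurable : Measurable toFun
  pos : ∀ ω, 0 < toFun ω
  le_one : ∀ ω, toFun ω ≤ 1

namespace Weight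

variable {Ω : Type*} [MeasurableSpace Ω] {P : Measure Ω} {𝕜 : Type*} [RCLike 𝕜]
  {S : Type*} [AddCommGroup S] [Module (Ω →ₘ[P] 𝕜) S]

/-- The product of two weights. -/
def mul (u v : Weight Ω) : Weight Ω where
  toFun ω := u.toFun ω * v.toFun ω
  measurable := u.measurable.mul v.measurable
  pos ω := mul_pos (u.pos ω) (v.pos ω)
  le_one ω := mul_le_one₀ (u.le_one ω) (v.pos ω).le (v.le_one ω)

/-- The weight `1 / (1 + |b|)`. -/
noncomputable def ofBound (b : Ω → ℝ) (hb : Measurable b) : Weight Ω where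
  toFun ω := (1 + |b ω|)⁻¹
  measurable := (measurable_const.add hb.abs).inv
  pos ω := by positivity
  le_one ω := inv_le_one_of_one_le₀ (by linarith [abs_nonneg (b ω)])

/-- The class of a weight in `L⁰(F, 𝕜)`. -/
noncomputable def cls (P : Measure Ω) (𝕜 : Type*) [RCLike 𝕜] (u : Weight Ω) : Ω →ₘ[P] 𝕜 :=
  rv P 𝕜 u.toFun u.measurable

/-- The inverse of a weight in `L⁰(F, 𝕜)`. -/
noncomputable def inv (P : Measure Ω) (𝕜 : Type*) [RCLike 𝕜] (u : Weight Ω) : Ω →ₘ[P] 𝕜 :=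
  rv P 𝕜 (fun ω => (u.toFun ω)⁻¹) u.measurable.inv

theorem cls_mul (u v : Weight Ω) : (u.mul v).cls P 𝕜 = u.cls P 𝕜 * v.cls P 𝕜 :=
  (rv_mul u.measurable v.measurable).symm

theorem cls_mul_inv (u : Weight Ω) : u.cls P 𝕜 * u.inv P 𝕜 = 1 := by
  rw [cls, inv, rv_mul u.measurable (h := fun ω => (u.toFun ω)⁻¹) u.measurable.inv, ← rv_one]
  exact rv_congr _ _ (Eventually.of_forall fun ω => mul_inv_cancel₀ (u.pos ω).ne')

theorem cls_smul_inv_smul (u : Weight Ω) (x : S) : u.cls P 𝕜 • u.inv P 𝕜 • x = x := by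
  rw [smul_smul, cls_mul_inv, one_smul]

theorem inv_smul_cls_smul (u : Weight Ω) (x : S) : u.inv P 𝕜 • u.cls P 𝕜 • x = x := by
  rw [smul_smul, mul_comm, cls_mul_inv, one_smul]

theorem smul_cancel (u : Weight Ω) {x y : S} (h : u.cls P 𝕜 • x = u.cls P 𝕜 • y) : x = y := by
  rw [← u.inv_smul_cls_smul (P := P) (𝕜 := 𝕜) x, h, inv_smul_cls_smul]

theorem smul_ae (u : Weight Ω) (N : L0Norm P 𝕜 S) (x : S) :
    ∀ᵐ ω ∂P, N (u.cls P 𝕜 • x) ω = u.toFun ω * N x ω := by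
  filter_upwards [N.rv_smul_ae u.measurable x] with ω h
  rw [cls, h, abs_of_pos (u.pos ω)]

theorem boundedBy (u : Weight Ω) (N : L0Norm P 𝕜 S) :
    BoundedBy N (LinearMap.lsmul (Ω →ₘ[P] 𝕜) S (u.cls P 𝕜)) (fun _ => 1) where
  measurable := measurable_const
  nonneg := Eventually.of_forall fun _ => zero_le_one
  le z := by
    filter_upwards [u.smul_ae N z, N.nonneg_ae z] with ω h h'
    rw [LinearMap.lsmul_apply, h]
    exact mul_le_mul_of_nonneg_right (u.le_one ω) h'

/-- Dividing `T` by `1 + |b|` makes it a contraction, which therefore acts on the integrable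
elements, unlike `T` itself. -/
theorem ofBound_boundedBy {N : L0Norm P 𝕜 S} {T : S →ₗ[Ω →ₘ[P] 𝕜] S} {b : Ω → ℝ}
    (hT : BoundedBy N T b) :
    BoundedBy N ((ofBound b hT.measurable).cls P 𝕜 • T : S →ₗ[Ω →ₘ[P] 𝕜] S) (fun _ => 1) where
  measurable := measurable_const
  nonneg := Eventually.of_forall fun _ => zero_le_one
  le z := by
    filter_upwards [(ofBound b hT.measurable).smul_ae N (T z), N.nonneg_ae z, hT.le z]
      with ω h h' h''
    rw [LinearMap.smul_apply, h]
    have hpos : 0 < 1 + |b ω| := by positivity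
    change (1 + |b ω|)⁻¹ * _ ≤ _
    rw [inv_mul_le_iff₀ hpos]
    nlinarith [le_abs_self (b ω)]

end Weight

/-! ### Integrals over the half-line up to a weight -/

section HalfLine

variable {Ω : Type*} [MeasurableSpace Ω] {P : Measure Ω} {𝕜 : Type*} [RCLike 𝕜]
  {S : Type*} [AddCommGroup S] [Module (Ω →ₘ[P] 𝕜) S] [Module 𝕜 S]
  [IsScalarTower 𝕜 (Ω →ₘ[P] 𝕜) S]

/-- `y` is the integral of `F` over the half-line `(0, ∞)`: after multiplication by a suitable
weight, `F` is Bochner integrable in the space of elements with integrable norm. -/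
def IsHalfLineIntegral (N : L0Norm P 𝕜 S) (F : ℝ → S) (y : S) : Prop :=
  ∃ (u : Weight Ω) (f : ℝ → N.integrable), IntegrableOn f (Set.Ioi 0) ∧
    (∀ t > 0, (f t : S) = u.cls P 𝕜 • F t) ∧
    u.cls P 𝕜 • y = ((∫ t in Set.Ioi 0, f t : N.integrable) : S)

namespace IsHalfLineIntegral

variable {N : L0Norm P 𝕜 S} {F G : ℝ → S} {y z : S}

theorem coe_integral_contraction [CompleteSpace N.integrable] {T : S →ₗ[Ω →ₘ[P] 𝕜] S}
    (hT : BoundedBy N T (fun _ => 1)) {f : ℝ → N.integrable} {s : Set ℝ} (hf : IntegrableOn f s) :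
    ((∫ t in s, contractionCLM hT (f t) : N.integrable) : S) =
      T (∫ t in s, f t : N.integrable) := by
  rw [ContinuousLinearMap.integral_comp_comm _ hf]
  rfl

/-- The weight absorbs the bound of `T`: the rescaled operator is a continuous linear map of the
Banach space and commutes with the Bochner integral. -/
theorem map [CompleteSpace N.integrable] (h : IsHalfLineIntegral N F y)
    {T : S →ₗ[Ω →ₘ[P] 𝕜] S} {b : Ω → ℝ} (hT : BoundedBy N T b) :
    IsHalfLineIntegral N (fun t => T (F t)) (T y) := by
  obtain ⟨u, f, hf, hfF, hy⟩ := h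
  have hT' := Weight.ofBound_boundedBy hT
  refine ⟨(Weight.ofBound b hT.measurable).mul u, fun t => contractionCLM hT' (f t),
    (contractionCLM hT').integrable_comp hf, fun t ht => ?_, ?_⟩
  · rw [coe_contractionCLM, hfF t ht, map_smul, LinearMap.smul_apply, Weight.cls_mul, smul_smul,
      mul_comm]
  · rw [coe_integral_contraction hT' hf, ← hy, map_smul, LinearMap.smul_apply, Weight.cls_mul,
      smul_smul, mul_comm]

theorem congr (h : IsHalfLineIntegral N F y) (hFG : ∀ t > 0, F t = G t) :
    IsHalfLineIntegral N G y := by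
  obtain ⟨u, f, hf, hfF, hy⟩ := h
  exact ⟨u, f, hf, fun t ht => by rw [hfF t ht, hFG t ht], hy⟩

/-- Independence of the weight: for weights `u` and `v` both integrals become the integral of `uvF`
after crosswise multiplication, and `uv` can be cancelled. -/
theorem unique [CompleteSpace N.integrable] (hy : IsHalfLineIntegral N F y)
    (hz : IsHalfLineIntegral N F z) : y = z := by
  obtain ⟨u, f, hf, hfF, hy⟩ := hy
  obtain ⟨v, g, hg, hgF, hz⟩ := hz
  refine (u.mul v).smul_cancel (P := P) (𝕜 := 𝕜) ?_
  rw [Weight.cls_mul, mul_smul, mul_smul, smul_comm, hy, hz]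
  have h1 := coe_integral_contraction (v.boundedBy N) hf
  have h2 := coe_integral_contraction (u.boundedBy N) hg
  rw [LinearMap.lsmul_apply] at h1 h2
  rw [← h1, ← h2]
  congr 1
  refine setIntegral_congr_fun measurableSet_Ioi fun t (ht : 0 < t) => Subtype.ext ?_
  rw [coe_contractionCLM, coe_contractionCLM, LinearMap.lsmul_apply, LinearMap.lsmul_apply,
    hfF t ht, hgF t ht, smul_comm]

theorem add [CompleteSpace N.integrable] (hy : IsHalfLineIntegral N F y)
    (hz : IsHalfLineIntegral N G z) : IsHalfLineIntegral N (fun t => F t + G t) (y + z) := by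
  obtain ⟨u, f, hf, hfF, hy⟩ := hy
  obtain ⟨v, g, hg, hgG, hz⟩ := hz
  have hf' := (contractionCLM (v.boundedBy N)).integrable_comp hf
  have hg' := (contractionCLM (u.boundedBy N)).integrable_comp hg
  refine ⟨u.mul v, _, hf'.add hg', fun t ht => ?_, ?_⟩
  · simp only [Pi.add_apply, Submodule.coe_add, coe_contractionCLM, LinearMap.lsmul_apply]
    rw [hfF t ht, hgG t ht, Weight.cls_mul, smul_add, mul_smul, mul_smul, smul_comm]
  · have h := integral_add hf' hg'
    simp only [Pi.add_apply]
    rw [h, Submodule.coe_add, coe_integral_contraction (v.boundedBy N) hf,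
      coe_integral_contraction (u.boundedBy N) hg, ← hy, ← hz, LinearMap.lsmul_apply,
      LinearMap.lsmul_apply, Weight.cls_mul, smul_add, mul_smul, mul_smul, smul_comm]

theorem integral_exp_neg_mul {κ : ℝ} (hκ : 0 < κ) :
    ∫⁻ t in Set.Ioi (0 : ℝ), ENNReal.ofReal (Real.exp (-κ * t)) = ENNReal.ofReal κ⁻¹ := by
  rw [← ofReal_integral_eq_lintegral_ofReal (integrableOn_exp_mul_Ioi (neg_neg_of_pos hκ) 0)
    (Eventually.of_forall fun t => (Real.exp_pos _).le), integral_exp_mul_Ioi (neg_neg_of_pos hκ)]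
  congr 1
  field_simp
  simp

/-- The Banach norm only controls means, so `F` is first cut down to an arbitrary measurable set
`A`. The norm inequality for the integral and Tonelli bound the mean of `u‖y‖` over each `A`, and
the arbitrariness of `A` turns this into an almost sure inequality. -/
theorem norm_le [CompleteSpace N.integrable] [IsProbabilityMeasure P]
    (hy : IsHalfLineIntegral N F y) {g κ : Ω → ℝ}
    (hg : Measurable g) (hκ : Measurable κ) (hg0 : ∀ᵐ ω ∂P, 0 ≤ g ω) (hκ0 : ∀ᵐ ω ∂P, 0 < κ ω)
    (hF : ∀ t > 0, ∀ᵐ ω ∂P, N (F t) ω ≤ g ω * Real.exp (-κ ω * t)) :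
    ∀ᵐ ω ∂P, N y ω ≤ g ω * (κ ω)⁻¹ := by
  obtain ⟨u, f, hf, hfF, hy⟩ := hy
  have hm : Measurable (Function.uncurry fun (t : ℝ) (ω : Ω) =>
      ENNReal.ofReal (u.toFun ω * g ω * Real.exp (-κ ω * t))) := by
    have hs : Measurable (Prod.snd : ℝ × Ω → Ω) := measurable_snd
    have h1 := u.measurable.comp hs
    have h2 := hg.comp hs
    have h3 := hκ.comp hs
    exact ((h1.mul h2).mul (h3.neg.mul measurable_fst).exp).ennreal_ofReal
  have hrhs : Measurable fun ω => ENNReal.ofReal (u.toFun ω * g ω * (κ ω)⁻¹) :=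
    ((u.measurable.mul hg).mul hκ.inv).ennreal_ofReal
  have key : ∀ A : Set Ω, MeasurableSet A →
      ∫⁻ ω in A, ENNReal.ofReal (u.toFun ω * N y ω) ∂P ≤
        ∫⁻ ω in A, ENNReal.ofReal (u.toFun ω * g ω * (κ ω)⁻¹) ∂P := by
    intro A hA
    have hmA := (measurable_one (α := ℝ)).indicator hA
    have hTA : BoundedBy N (LinearMap.lsmul (Ω →ₘ[P] 𝕜) S (rv P 𝕜 (A.indicator 1) hmA))
        (fun _ => 1) := by
      refine ⟨measurable_const, Eventually.of_forall fun _ => zero_le_one, fun z => ?_⟩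
      filter_upwards [N.rv_smul_ae hmA z, N.nonneg_ae z] with ω h1 h2
      rw [LinearMap.lsmul_apply, h1]
      by_cases h : ω ∈ A <;> simp [h, h2]
    have hA_eq : ∀ z : S, ∫⁻ ω, ENNReal.ofReal
        (N (rv P 𝕜 (A.indicator 1) hmA • z) ω) ∂P = ∫⁻ ω in A, ENNReal.ofReal (N z ω) ∂P := by
      intro z
      rw [← lintegral_indicator hA]
      refine lintegral_congr_ae ?_
      filter_upwards [N.rv_smul_ae hmA z] with ω h1
      rw [h1]
      by_cases h : ω ∈ A <;> simp [h]
    have h1 : ∫⁻ ω in A, ENNReal.ofReal (u.toFun ω * N y ω) ∂P =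
        ‖∫ t in Set.Ioi 0, contractionCLM hTA (f t)‖ₑ := by
      rw [integrable_enorm_eq, coe_integral_contraction hTA hf, LinearMap.lsmul_apply, ← hy, hA_eq]
      refine lintegral_congr_ae (ae_restrict_of_ae ?_)
      filter_upwards [u.smul_ae N y] with ω h
      rw [h]
    have h2 : ∀ t > 0, ‖contractionCLM hTA (f t)‖ₑ ≤
        ∫⁻ ω in A, ENNReal.ofReal (u.toFun ω * g ω * Real.exp (-κ ω * t)) ∂P := by
      intro t ht
      rw [integrable_enorm_eq, coe_contractionCLM, LinearMap.lsmul_apply, hfF t ht, hA_eq]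
      refine lintegral_mono_ae (ae_restrict_of_ae ?_)
      filter_upwards [u.smul_ae N (F t), hF t ht] with ω h h'
      rw [h, mul_assoc]
      exact ENNReal.ofReal_le_ofReal (mul_le_mul_of_nonneg_left h' (u.pos ω).le)
    rw [h1]
    refine (enorm_integral_le_lintegral_enorm _).trans ?_
    refine (setLIntegral_mono' measurableSet_Ioi h2).trans ?_
    rw [lintegral_lintegral_swap hm.aemeasurable]
    refine lintegral_mono_ae (ae_restrict_of_ae ?_)
    filter_upwards [hκ0, hg0] with ω h h'
    have hug : 0 ≤ u.toFun ω * g ω := mul_nonneg (u.pos ω).le h'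
    simp_rw [ENNReal.ofReal_mul hug]
    rw [lintegral_const_mul _ (by fun_prop), integral_exp_neg_mul h]
  have hae := ae_le_of_forall_setLIntegral_le_of_sigmaFinite (μ := P)
    ((u.measurable.mul (N y).measurable).ennreal_ofReal) (fun A hA _ => key A hA)
  filter_upwards [hae, hκ0, hg0] with ω h1 h2 h3
  have hug : 0 ≤ u.toFun ω * g ω := mul_nonneg (u.pos ω).le h3
  rw [ENNReal.ofReal_le_ofReal_iff (mul_nonneg hug (inv_nonneg.2 h2.le)), mul_assoc] at h1
  exact le_of_mul_le_mul_left h1 (u.pos ω)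

end IsHalfLineIntegral

end HalfLine

end RandomNormed

namespace RandomNormed

/-! ### Laplace transform of a decaying `C`-semigroup -/

section Decaying

variable {Ω : Type*} [MeasurableSpace Ω] {P : Measure Ω} [IsProbabilityMeasure P]
  {𝕜 : Type*} [RCLike 𝕜] {S : Type*} [AddCommGroup S] [Module (Ω →ₘ[P] 𝕜) S]

/-- A `C`-semigroup of `L⁰(F, 𝕜)`-linear operators with `‖V(t)‖ ≤ M e ^ (-κ t)` and `κ > 0`. -/
structure IsDecayingCSemigroup (N : L0Norm P 𝕜 S) (C : S →ₗ[Ω →ₘ[P] 𝕜] S)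
    (V : ℝ≥0 → S →ₗ[Ω →ₘ[P] 𝕜] S) (M κ : Ω → ℝ) : Prop where
  measurable_M : Measurable M
  measurable_κ : Measurable κ
  M_nonneg : ∀ᵐ ω ∂P, 0 ≤ M ω
  κ_pos : ∀ᵐ ω ∂P, 0 < κ ω
  injective : Function.Injective C
  zero : ∀ x, V 0 x = C x
  mul : ∀ s t x, C (V (s + t) x) = V t (V s x)
  le : ∀ (t : ℝ≥0) x, ∀ᵐ ω ∂P, N (V t x) ω ≤ M ω * Real.exp (-κ ω * t) * N x ω
  tendsto : ∀ x t, Tendsto (fun s => V s x) (𝓝 t) (@nhds S N.topology (V t x))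

/-- `C y = lim_{s → 0+} (V(s) x - C x) / s`. -/
def IsRightDeriv [Module 𝕜 S] (N : L0Norm P 𝕜 S) (C : S → S) (V : ℝ≥0 → S → S) (x y : S) : Prop :=
  Tendsto (fun s : ℝ≥0 => (((s : ℝ)⁻¹ : ℝ) : 𝕜) • (V s x - C x)) (𝓝[>] 0)
    (@nhds S N.topology (C y))

instance nhdsGT_zero_neBot : (𝓝[>] (0 : ℝ≥0)).NeBot :=
  nhdsGT_neBot_of_exists_gt ⟨1, one_pos⟩

theorem IsRightDeriv.map [Module 𝕜 S] [IsScalarTower 𝕜 (Ω →ₘ[P] 𝕜) S] {N : L0Norm P 𝕜 S}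
    {C : S →ₗ[Ω →ₘ[P] 𝕜] S} {V : ℝ≥0 → S →ₗ[Ω →ₘ[P] 𝕜] S} {x y : S}
    (h : IsRightDeriv N C (fun s => V s) x y) {T : S →ₗ[Ω →ₘ[P] 𝕜] S} {b : Ω → ℝ}
    (hT : BoundedBy N T b) (hTC : ∀ z, T (C z) = C (T z)) (hTV : ∀ s z, T (V s z) = V s (T z)) :
    IsRightDeriv N C (fun s => V s) (T x) (T y) := by
  have h1 := hT.tendsto h
  rw [hTC] at h1
  refine h1.congr fun s => ?_
  rw [map_csmul, map_sub, hTC, hTV]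

/-- It trades the random decay rate `κ` for the deterministic integrable profile `1/(1+t²)` at the
cost of a random constant. The `2/κ²` comes from the quadratic term of the exponential series. -/
theorem one_add_sq_le_exp_mul {κ t : ℝ} (hκ : 0 < κ) (ht : 0 ≤ t) :
    1 + t ^ 2 ≤ (1 + 2 / κ ^ 2) * Real.exp (κ * t) := by
  have h1 := Real.quadratic_le_exp_of_nonneg (mul_nonneg hκ.le ht)
  have h2 : 1 ≤ Real.exp (κ * t) := Real.one_le_exp (mul_nonneg hκ.le ht)
  have h3 : t ^ 2 ≤ 2 / κ ^ 2 * Real.exp (κ * t) := by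
    rw [div_mul_eq_mul_div, le_div_iff₀ (by positivity)]
    nlinarith [mul_nonneg hκ.le ht]
  linarith

namespace IsDecayingCSemigroup

variable {N : L0Norm P 𝕜 S} {C : S →ₗ[Ω →ₘ[P] 𝕜] S} {V : ℝ≥0 → S →ₗ[Ω →ₘ[P] 𝕜] S} {M κ : Ω → ℝ}

theorem comm (hV : IsDecayingCSemigroup N C V M κ) (s t : ℝ≥0) (x : S) :
    V s (V t x) = V t (V s x) := by
  rw [← hV.mul, ← hV.mul, add_comm]

theorem boundedBy (hV : IsDecayingCSemigroup N C V M κ) (s : ℝ≥0) : BoundedBy N (V s) M where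
  measurable := hV.measurable_M
  nonneg := hV.M_nonneg
  le z := by
    filter_upwards [hV.le s z, hV.κ_pos, hV.M_nonneg, N.nonneg_ae z] with ω h1 h2 h3 h4
    refine h1.trans (mul_le_mul_of_nonneg_right ?_ h4)
    refine mul_le_of_le_one_right h3 (Real.exp_le_one_iff.2 ?_)
    nlinarith [s.coe_nonneg]

theorem boundedBy_C (hV : IsDecayingCSemigroup N C V M κ) : BoundedBy N C M := by
  have h : ⇑(V 0) = ⇑C := funext hV.zero
  rw [← h]
  exact hV.boundedBy 0

variable [Module 𝕜 S] [IsScalarTower 𝕜 (Ω →ₘ[P] 𝕜) S]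

/-- A single weight serves all times: with `b = M‖x‖(1 + 2/κ²)` the orbit has norm at most
`b/(1+t²)`, so dividing by `1 + b` leaves a deterministic integrable bound. This bound also upgrades
continuity in probability to continuity in mean. -/
theorem exists_orbit (hV : IsDecayingCSemigroup N C V M κ) (x : S) :
    ∃ (u : Weight Ω) (f : ℝ → N.integrable), Continuous f ∧ IntegrableOn f (Set.Ioi 0) ∧
      ∀ t, (f t : S) = u.cls P 𝕜 • V t.toNNReal x := by
  have hb : Measurable fun ω => M ω * N x ω * (1 + 2 / κ ω ^ 2) :=
    (hV.measurable_M.mul (N x).measurable).mul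
      (measurable_const.add (measurable_const.div (hV.measurable_κ.pow_const 2)))
  let u := Weight.ofBound _ hb
  have hle : ∀ t : ℝ≥0, ∀ᵐ ω ∂P, N (u.cls P 𝕜 • V t x) ω ≤ (1 + (t : ℝ) ^ 2)⁻¹ := by
    intro t
    filter_upwards [u.smul_ae N (V t x), hV.le t x, hV.κ_pos, hV.M_nonneg, N.nonneg_ae x]
      with ω h1 h2 h3 h4 h5
    rw [h1]
    have hMx : 0 ≤ M ω * N x ω := mul_nonneg h4 h5
    have hb0 : 0 ≤ M ω * N x ω * (1 + 2 / κ ω ^ 2) := by positivity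
    have hexp := one_add_sq_le_exp_mul h3 t.coe_nonneg
    change (1 + |M ω * N x ω * (1 + 2 / κ ω ^ 2)|)⁻¹ * _ ≤ _
    rw [abs_of_nonneg hb0, inv_mul_le_iff₀ (by positivity)]
    refine h2.trans ?_
    rw [← div_eq_mul_inv, le_div_iff₀ (by positivity)]
    have he : Real.exp (-κ ω * t) * Real.exp (κ ω * t) = 1 := by
      rw [← Real.exp_add]
      simp
    calc M ω * Real.exp (-κ ω * t) * N x ω * (1 + (t : ℝ) ^ 2)
        ≤ M ω * Real.exp (-κ ω * t) * N x ω * ((1 + 2 / κ ω ^ 2) * Real.exp (κ ω * t)) := by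
          gcongr
      _ = M ω * N x ω * (1 + 2 / κ ω ^ 2) * (Real.exp (-κ ω * t) * Real.exp (κ ω * t)) := by ring
      _ ≤ 1 + M ω * N x ω * (1 + 2 / κ ω ^ 2) := by rw [he]; linarith
  have hle1 : ∀ t : ℝ≥0, ∀ᵐ ω ∂P, N (u.cls P 𝕜 • V t x) ω ≤ 1 := fun t =>
    (hle t).mono fun ω h => h.trans (inv_le_one_of_one_le₀ (by nlinarith [t.coe_nonneg]))
  let f : ℝ → N.integrable := fun t => ⟨u.cls P 𝕜 • V t.toNNReal x, integrable_of_le (hle1 _)⟩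
  have hcont : Continuous f := by
    refine continuous_iff_continuousAt.2 fun t => ?_
    have h1 : Tendsto (fun s : ℝ => u.cls P 𝕜 • V s.toNNReal x) (𝓝 t)
        (@nhds S N.topology (u.cls P 𝕜 • V t.toNNReal x)) :=
      (boundedBy_lsmul N (u.cls P 𝕜)).tendsto
        ((hV.tendsto x t.toNNReal).comp (continuous_real_toNNReal.tendsto t))
    -- Both weighted orbit points have norm at most one, so their difference has norm at most two.
    refine tendsto_of_tendstoZero (K := 2) (Eventually.of_forall fun s => ?_) (N.tendsto_iff.1 h1)
    filter_upwards [hle1 s.toNNReal, hle1 t.toNNReal,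
      N.sub_le_ae (u.cls P 𝕜 • V s.toNNReal x) (u.cls P 𝕜 • V t.toNNReal x)] with ω h2 h3 h4
    refine h4.trans ?_
    linarith
  refine ⟨u, f, hcont, ?_, fun t => rfl⟩
  refine Integrable.mono' integrable_inv_one_add_sq.integrableOn
    hcont.aestronglyMeasurable.restrict ?_
  filter_upwards [ae_restrict_mem measurableSet_Ioi] with t (ht : 0 < t)
  refine norm_le_of_le ?_
  have := hle t.toNNReal
  rwa [Real.coe_toNNReal t ht.le] at this

theorem exists_integral (hV : IsDecayingCSemigroup N C V M κ) (x : S) :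
    ∃ y, IsHalfLineIntegral N (fun t => V t.toNNReal x) y := by
  obtain ⟨u, f, -, hf, hfV⟩ := hV.exists_orbit x
  exact ⟨u.inv P 𝕜 • (∫ t in Set.Ioi 0, f t : N.integrable), u, f, hf, fun t _ => hfV t,
    u.cls_smul_inv_smul _⟩

omit [IsScalarTower 𝕜 (Ω →ₘ[P] 𝕜) S] in
theorem isRightDeriv_unique (hV : IsDecayingCSemigroup N C V M κ) {x y z : S}
    (hy : IsRightDeriv N C (fun s => V s) x y) (hz : IsRightDeriv N C (fun s => V s) x z) : y = z :=
  hV.injective (N.tendsto_unique hy hz)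

variable [CompleteSpace N.integrable]

/-- The Laplace transform `∫_0^∞ V(t) x dt` of a decaying `C`-semigroup. -/
noncomputable def laplace (hV : IsDecayingCSemigroup N C V M κ) : S →ₗ[Ω →ₘ[P] 𝕜] S where
  toFun x := (hV.exists_integral x).choose
  map_add' x y := by
    refine (hV.exists_integral (x + y)).choose_spec.unique ?_
    refine ((hV.exists_integral x).choose_spec.add (hV.exists_integral y).choose_spec).congr
      fun _ _ => ?_
    rw [map_add]
  map_smul' ζ x := by
    refine (hV.exists_integral (ζ • x)).choose_spec.unique ?_
    refine ((hV.exists_integral x).choose_spec.map (boundedBy_lsmul N ζ)).congr ?_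
    intro t _
    rw [map_smul, LinearMap.lsmul_apply]

theorem isIntegral_laplace (hV : IsDecayingCSemigroup N C V M κ) (x : S) :
    IsHalfLineIntegral N (fun t => V t.toNNReal x) (hV.laplace x) :=
  (hV.exists_integral x).choose_spec

theorem laplace_boundedBy (hV : IsDecayingCSemigroup N C V M κ) :
    BoundedBy N hV.laplace (fun ω => M ω * (κ ω)⁻¹) where
  measurable := hV.measurable_M.mul hV.measurable_κ.inv
  nonneg := by
    filter_upwards [hV.M_nonneg, hV.κ_pos] with ω h1 h2
    positivity
  le x := by
    have h0 : ∀ᵐ ω ∂P, 0 ≤ M ω * N x ω := by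
      filter_upwards [hV.M_nonneg, N.nonneg_ae x] with ω h1 h2 using mul_nonneg h1 h2
    have h := (hV.isIntegral_laplace x).norm_le (hV.measurable_M.mul (N x).measurable)
      hV.measurable_κ h0 hV.κ_pos (fun t ht => by
        filter_upwards [hV.le t.toNNReal x] with ω h1
        rw [Real.coe_toNNReal t ht.le] at h1
        change _ ≤ M ω * N x ω * _
        linarith)
    filter_upwards [h] with ω h1
    change _ ≤ M ω * N x ω * _ at h1
    linarith

theorem comm_laplace (hV : IsDecayingCSemigroup N C V M κ) (s : ℝ≥0) (x : S) :
    V s (hV.laplace x) = hV.laplace (V s x) :=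
  (((hV.isIntegral_laplace x).map (hV.boundedBy s)).congr fun _ _ => hV.comm _ _ _).unique
    (hV.isIntegral_laplace (V s x))

theorem C_laplace (hV : IsDecayingCSemigroup N C V M κ) (x : S) :
    C (hV.laplace x) = hV.laplace (C x) := by
  have h := hV.comm_laplace 0 x
  rwa [hV.zero, hV.zero] at h

/-- With `L` the transform, `V(h)V(t) = C V(t+h)` and translation give `V(h)Lx - C Lx = -C ∫_0^h
V(t)x dt`. Dividing by `h` yields `-C(Cx)` in the limit, because `V(0) = C`. -/
theorem isRightDeriv_laplace (hV : IsDecayingCSemigroup N C V M κ) (x : S) :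
    IsRightDeriv N C (fun s => V s) (hV.laplace x) (-C x) := by
  obtain ⟨u, f, hfc, hf, hfV⟩ := hV.exists_orbit x
  have hy : u.cls P 𝕜 • hV.laplace x = ((∫ t in Set.Ioi 0, f t : N.integrable) : S) := by
    have h : IsHalfLineIntegral N (fun t => V t.toNNReal x)
        (u.inv P 𝕜 • (∫ t in Set.Ioi 0, f t : N.integrable)) :=
      ⟨u, f, hf, fun t _ => hfV t, u.cls_smul_inv_smul _⟩
    rw [(hV.isIntegral_laplace x).unique h, u.cls_smul_inv_smul]
  have hmp : ∀ h : ℝ, MeasurePreserving (fun t : ℝ => t + h) volume volume :=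
    fun h => measurePreserving_add_right volume h
  have hpre : ∀ {h : ℝ}, (fun t : ℝ => t + h) ⁻¹' Set.Ioi h = Set.Ioi 0 := by
    intro h
    rw [Set.preimage_add_const_Ioi, sub_self]
  -- The outer `C` is kept explicit: the fundamental theorem of calculus is applied to the integral
  -- inside it, and `C` is never inverted.
  have hV_eq : ∀ h : ℝ≥0, V h (hV.laplace x) - C (hV.laplace x) =
      C (u.inv P 𝕜 • (-(∫ t in (0 : ℝ)..h, f t) : N.integrable)) := by
    intro h
    have hfh : IntegrableOn (fun t => f (t + h)) (Set.Ioi 0) := by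
      have := (hmp h).integrableOn_comp_preimage (measurableEmbedding_addRight (h : ℝ))
        (f := f) (s := Set.Ioi (h : ℝ))
      rw [hpre] at this
      exact this.2 (hf.mono_set (Set.Ioi_subset_Ioi h.coe_nonneg))
    have h1 : IsHalfLineIntegral N (fun t => V (t.toNNReal + h) x)
        (u.inv P 𝕜 • (∫ t in Set.Ioi 0, f (t + h) : N.integrable)) := by
      refine ⟨u, fun t => f (t + h), hfh, fun t ht => ?_, u.cls_smul_inv_smul _⟩
      rw [hfV, Real.toNNReal_add (le_of_lt ht) h.coe_nonneg, Real.toNNReal_coe]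
    have h2 := ((hV.isIntegral_laplace x).map (hV.boundedBy h)).unique
      ((h1.map hV.boundedBy_C).congr fun t _ => hV.mul _ _ _)
    rw [h2, ← map_sub]
    congr 1
    refine u.smul_cancel (P := P) (𝕜 := 𝕜) ?_
    rw [smul_sub, u.cls_smul_inv_smul, u.cls_smul_inv_smul, hy, ← Submodule.coe_sub]
    congr 1
    have h3 := (hmp h).setIntegral_preimage_emb (measurableEmbedding_addRight (h : ℝ)) f
      (Set.Ioi (h : ℝ))
    rw [hpre] at h3
    rw [h3, ← intervalIntegral.integral_Ioi_sub_Ioi hf h.coe_nonneg]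
    abel
  have hderiv : HasDerivAt (fun h : ℝ => ∫ t in (0 : ℝ)..h, f t) (f 0) 0 :=
    intervalIntegral.integral_hasDerivAt_right (hfc.intervalIntegrable _ _)
      hfc.aestronglyMeasurable.stronglyMeasurableAtFilter hfc.continuousAt
  have hslope := hasDerivAt_iff_tendsto_slope_zero.1 hderiv
  have hcoe : Tendsto (fun s : ℝ≥0 => (s : ℝ)) (𝓝[>] 0) (𝓝[≠] 0) := by
    refine tendsto_nhdsWithin_iff.2 ⟨?_, ?_⟩
    · exact (NNReal.continuous_coe.tendsto 0).mono_left nhdsWithin_le_nhds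
    · filter_upwards [self_mem_nhdsWithin] with s (hs : 0 < s)
      exact (NNReal.coe_pos.2 hs).ne'
  have h4 := (hslope.comp hcoe).neg
  have h5 := N.tendsto_iff.2 (tendstoZero_of_tendsto h4)
  have h6 := hV.boundedBy_C.tendsto ((boundedBy_lsmul N (u.inv P 𝕜)).tendsto h5)
  have hf0 : u.inv P 𝕜 • ((-f 0 : N.integrable) : S) = -C x := by
    rw [Submodule.coe_neg, hfV, Real.toNNReal_zero, hV.zero, smul_neg, u.inv_smul_cls_smul]
  rw [LinearMap.lsmul_apply, hf0] at h6
  refine h6.congr fun s => ?_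
  have hsm : ∀ (c : 𝕜) (z : S), u.inv P 𝕜 • c • z = c • u.inv P 𝕜 • z :=
    fun c z => map_csmul (LinearMap.lsmul (Ω →ₘ[P] 𝕜) S (u.inv P 𝕜)) c z
  rw [hV_eq s, ← map_csmul, ← hsm]
  simp only [Function.comp, zero_add, intervalIntegral.integral_same, sub_zero,
    LinearMap.lsmul_apply]
  rw [← smul_neg, coe_real_smul]

/-- The transform commutes with `C` and every `V(s)`, so it carries the derivative at `x` to one at
its image. That derivative is already known to be `-Cx`, and derivatives are unique since `C` is
injective. -/
theorem laplace_of_isRightDeriv (hV : IsDecayingCSemigroup N C V M κ) {x y : S}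
    (h : IsRightDeriv N C (fun s => V s) x y) : hV.laplace y = -C x :=
  hV.isRightDeriv_unique (h.map hV.laplace_boundedBy
    (fun z => (hV.C_laplace z).symm) (fun s z => (hV.comm_laplace s z).symm))
    (hV.isRightDeriv_laplace x)

end IsDecayingCSemigroup

end Decaying

end RandomNormed

namespace RandomNormed

/-! ### Multiplying a semigroup by a random exponential -/

section ExponentialShift

/-- A Lipschitz estimate with any common upper bound `c` of the exponents, so that at each `ω` one
constant serves all times in a bounded interval. -/
theorem abs_exp_sub_exp_le {a b c : ℝ} (ha : a ≤ c) (hb : b ≤ c) :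
    |Real.exp a - Real.exp b| ≤ |a - b| * Real.exp c := by
  have key : ∀ {a b : ℝ}, a ≤ c → Real.exp a - Real.exp b ≤ |a - b| * Real.exp c := by
    intro a b ha
    have h1 := Real.add_one_le_exp (b - a)
    have h2 : Real.exp b = Real.exp a * Real.exp (b - a) := by
      rw [← Real.exp_add, add_sub_cancel]
    have h3 : Real.exp a ≤ Real.exp c := Real.exp_le_exp.2 ha
    have h4 : Real.exp a - Real.exp b ≤ (a - b) * Real.exp a := by
      rw [h2]
      nlinarith [Real.exp_pos a]
    calc _ ≤ (a - b) * Real.exp a := h4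
      _ ≤ |a - b| * Real.exp a := mul_le_mul_of_nonneg_right (le_abs_self _) (Real.exp_pos a).le
      _ ≤ _ := mul_le_mul_of_nonneg_left h3 (abs_nonneg _)
  rw [abs_le]
  constructor
  · have := key (a := b) (b := a) hb
    rw [abs_sub_comm] at this
    linarith
  · exact key ha

theorem abs_exp_sub_one_sub_le (x : ℝ) :
    |Real.exp x - 1 - x| ≤ x ^ 2 * Real.exp |x| := by
  have h1 := Real.add_one_le_exp x
  have h2 := Real.add_one_le_exp (-x)
  have h3 := abs_exp_sub_exp_le (le_abs_self x) (abs_nonneg x)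
  rw [Real.exp_zero, sub_zero] at h3
  have h4 : Real.exp x * Real.exp (-x) = 1 := by rw [← Real.exp_add]; simp
  have h5 : Real.exp x - 1 - x ≤ x * (Real.exp x - 1) := by nlinarith [Real.exp_pos x]
  rw [abs_of_nonneg (by linarith)]
  refine h5.trans ((le_abs_self _).trans ?_)
  rw [abs_mul, ← sq_abs x]
  nlinarith [abs_nonneg x]

variable {Ω : Type*} [MeasurableSpace Ω] {P : Measure Ω} {𝕜 : Type*} [RCLike 𝕜]

theorem rv_add {g h : Ω → ℝ} (hg : Measurable g) (hh : Measurable h) :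
    rv P 𝕜 g hg + rv P 𝕜 h hh = rv P 𝕜 (fun ω => g ω + h ω) (hg.add hh) := by
  refine AEEqFun.ext ?_
  filter_upwards [AEEqFun.coeFn_add (rv P 𝕜 g hg) (rv P 𝕜 h hh), coeFn_rv (P := P) (𝕜 := 𝕜) hg,
    coeFn_rv (P := P) (𝕜 := 𝕜) hh,
    coeFn_rv (P := P) (𝕜 := 𝕜) (g := fun ω => g ω + h ω) (hg.add hh)] with ω h1 h2 h3 h4
  rw [h1, h4, Pi.add_apply, h2, h3]
  exact (RCLike.ofReal_add _ _).symm

theorem rv_sub {g h : Ω → ℝ} (hg : Measurable g) (hh : Measurable h) :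
    rv P 𝕜 g hg - rv P 𝕜 h hh = rv P 𝕜 (fun ω => g ω - h ω) (hg.sub hh) := by
  rw [sub_eq_iff_eq_add, rv_add (g := fun ω => g ω - h ω) (hg.sub hh) hh]
  exact rv_congr _ _ (Eventually.of_forall fun ω => (sub_add_cancel _ _).symm)

theorem measurable_exp_neg_mul {η : Ω → ℝ} (hη : Measurable η) (s : ℝ) :
    Measurable fun ω => Real.exp (-η ω * s) :=
  (hη.neg.mul_const s).exp

/-- The class of `e ^ (-η s)` in `L⁰(F, 𝕜)`. -/
noncomputable def expWeight (P : Measure Ω) (𝕜 : Type*) [RCLike 𝕜] {η : Ω → ℝ} (hη : Measurable η)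
    (s : ℝ) : Ω →ₘ[P] 𝕜 :=
  rv P 𝕜 _ (measurable_exp_neg_mul hη s)

theorem expWeight_zero {η : Ω → ℝ} (hη : Measurable η) : expWeight P 𝕜 hη 0 = 1 := by
  rw [← rv_one]
  exact rv_congr _ _ (Eventually.of_forall fun ω => by simp)

theorem expWeight_mul {η : Ω → ℝ} (hη : Measurable η) (s t : ℝ) :
    expWeight P 𝕜 hη s * expWeight P 𝕜 hη t = expWeight P 𝕜 hη (s + t) := by
  rw [expWeight, expWeight, rv_mul]
  exact rv_congr _ _ (Eventually.of_forall fun ω => by simp only [← Real.exp_add, mul_add])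

theorem expWeight_neg_mul {η : Ω → ℝ} (hη : Measurable η) (s : ℝ) :
    expWeight P 𝕜 hη.neg s * expWeight P 𝕜 hη s = 1 := by
  rw [expWeight, expWeight, rv_mul, ← rv_one]
  exact rv_congr _ _ (Eventually.of_forall fun ω => by simp [← Real.exp_add])

variable {S : Type*} [AddCommGroup S] [Module (Ω →ₘ[P] 𝕜) S]

theorem ofReal_smul_eq [Module 𝕜 S] [IsScalarTower 𝕜 (Ω →ₘ[P] 𝕜) S] (r : ℝ) (x : S) :
    (r : 𝕜) • x = rv P 𝕜 (fun _ => r) measurable_const • x := by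
  have h : rv P 𝕜 (fun _ : Ω => r) measurable_const = (r : 𝕜) • (1 : Ω →ₘ[P] 𝕜) := by
    refine AEEqFun.ext ?_
    filter_upwards [coeFn_rv (P := P) (𝕜 := 𝕜) (g := fun _ => r) measurable_const,
      AEEqFun.coeFn_smul (r : 𝕜) (1 : Ω →ₘ[P] 𝕜), AEEqFun.coeFn_one (α := Ω) (μ := P) (β := 𝕜)]
      with ω h1 h2 h3
    rw [h1, h2, Pi.smul_apply, h3]
    simp
  rw [h, smul_assoc, one_smul]

variable [IsProbabilityMeasure P] {N : L0Norm P 𝕜 S}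

/-- For `s ≤ t + 1` the factor `e^{-ηs}` is bounded by, and Lipschitz in `s` with, random constants
independent of `s`. Fixed random constants do not disturb convergence in probability. -/
theorem tendsto_expWeight_smul {η : Ω → ℝ} (hη : Measurable η) {U : ℝ≥0 → S} {t : ℝ≥0}
    (h : Tendsto U (𝓝 t) (@nhds S N.topology (U t))) :
    Tendsto (fun s : ℝ≥0 => expWeight P 𝕜 hη s • U s) (𝓝 t)
      (@nhds S N.topology (expWeight P 𝕜 hη t • U t)) := by
  rw [N.tendsto_iff] at h ⊢
  have hK : Measurable fun ω => Real.exp (|η ω| * (t + 1)) := (hη.abs.mul_const _).exp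
  have hK' : Measurable fun ω => |η ω| * Real.exp (|η ω| * (t + 1)) * N (U t) ω :=
    (hη.abs.mul hK).mul (N (U t)).measurable
  have hK0 : ∀ᵐ ω ∂P, 0 ≤ |η ω| * Real.exp (|η ω| * (t + 1)) * N (U t) ω := by
    filter_upwards [N.nonneg_ae (U t)] with ω h
    positivity
  have hlim : Tendsto (fun s : ℝ≥0 => |(s : ℝ) - t|) (𝓝 t) (𝓝 0) := by
    have h1 : Continuous fun s : ℝ≥0 => |(s : ℝ) - t| := by fun_prop
    simpa using h1.tendsto t
  refine ((h.mul_left _ hK (Eventually.of_forall fun ω => (Real.exp_pos _).le)).add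
    ((TendstoZero.of_tendsto hlim).mul_left _ hK' hK0)).mono ?_
  have hs1 : ∀ᶠ s : ℝ≥0 in 𝓝 t, s < t + 1 := gt_mem_nhds (lt_add_one t)
  filter_upwards [hs1] with s hs
  have hs' : (s : ℝ) ≤ t + 1 := by exact_mod_cast hs.le
  have hsplit : expWeight P 𝕜 hη s • U s - expWeight P 𝕜 hη t • U t =
      expWeight P 𝕜 hη s • (U s - U t) +
        rv P 𝕜 (fun ω => Real.exp (-η ω * s) - Real.exp (-η ω * t))
          ((measurable_exp_neg_mul hη s).sub (measurable_exp_neg_mul hη t)) • U t := by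
    rw [← rv_sub (measurable_exp_neg_mul hη s) (measurable_exp_neg_mul hη t), expWeight, expWeight]
    module
  rw [hsplit]
  filter_upwards [N.add_le_ae (expWeight P 𝕜 hη s • (U s - U t))
      (rv P 𝕜 (fun ω => Real.exp (-η ω * s) - Real.exp (-η ω * t))
        ((measurable_exp_neg_mul hη s).sub (measurable_exp_neg_mul hη t)) • U t),
    N.rv_smul_ae (measurable_exp_neg_mul hη s) (U s - U t),
    N.rv_smul_ae (g := fun ω => Real.exp (-η ω * s) - Real.exp (-η ω * t))
      ((measurable_exp_neg_mul hη s).sub (measurable_exp_neg_mul hη t)) (U t),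
    N.nonneg_ae (U s - U t), N.nonneg_ae (U t)] with ω h1 h2 h3 h4 h5
  have hb : ∀ r : ℝ, 0 ≤ r → r ≤ t + 1 → -η ω * r ≤ |η ω| * (t + 1) := by
    intro r hr hr'
    nlinarith [neg_abs_le (η ω), abs_nonneg (η ω)]
  have hbs := hb s s.coe_nonneg hs'
  have hbt := hb t t.coe_nonneg (by linarith)
  have h6 := abs_exp_sub_exp_le hbs hbt
  have h7 : |(-η ω * s) - (-η ω * t)| = |η ω| * |(s : ℝ) - t| := by
    rw [← abs_mul, ← abs_neg]
    ring_nf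
  rw [h7] at h6
  rw [expWeight, h2, h3, abs_of_pos (Real.exp_pos _)] at h1
  refine h1.trans (add_le_add (mul_le_mul_of_nonneg_right (Real.exp_le_exp.2 hbs) h4) ?_)
  refine (mul_le_mul_of_nonneg_right h6 h5).trans (le_of_eq ?_)
  ring

theorem tendsto_coe_nhdsGT_zero : Tendsto (fun s : ℝ≥0 => (s : ℝ)) (𝓝[>] 0) (𝓝 0) :=
  (NNReal.continuous_coe.tendsto 0).mono_left nhdsWithin_le_nhds

/-- The generator of `e ^ (-η s) U(s)` is the generator of `U` minus `η`. -/
theorem IsRightDeriv.expWeight_smul [Module 𝕜 S] [IsScalarTower 𝕜 (Ω →ₘ[P] 𝕜) S]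
    {C : S →ₗ[Ω →ₘ[P] 𝕜] S} {U : ℝ≥0 → S → S} {x y : S} (h : IsRightDeriv N C U x y) {η : Ω → ℝ}
    (hη : Measurable η) :
    IsRightDeriv N C (fun s z => expWeight P 𝕜 hη s • U s z) x (y - rv P 𝕜 η hη • x) := by
  rw [IsRightDeriv, N.tendsto_iff] at h ⊢
  have hK : Measurable fun ω => Real.exp |η ω| := hη.abs.exp
  have hK1 : Measurable fun ω => |η ω| * Real.exp |η ω| * N (C y) ω :=
    (hη.abs.mul hK).mul (N (C y)).measurable
  have hK2 : Measurable fun ω => η ω ^ 2 * Real.exp |η ω| * N (C x) ω :=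
    ((hη.pow_const 2).mul hK).mul (N (C x)).measurable
  have hK1' : ∀ᵐ ω ∂P, 0 ≤ |η ω| * Real.exp |η ω| * N (C y) ω := by
    filter_upwards [N.nonneg_ae (C y)] with ω h
    positivity
  have hK2' : ∀ᵐ ω ∂P, 0 ≤ η ω ^ 2 * Real.exp |η ω| * N (C x) ω := by
    filter_upwards [N.nonneg_ae (C x)] with ω h
    positivity
  have hlim := TendstoZero.of_tendsto (P := P) tendsto_coe_nhdsGT_zero
  refine (((h.mul_left _ hK (Eventually.of_forall fun ω => (Real.exp_pos _).le)).add
    (hlim.mul_left _ hK1 hK1')).add (hlim.mul_left _ hK2 hK2')).mono ?_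
  have hs1 : ∀ᶠ s : ℝ≥0 in 𝓝[>] 0, s < 1 := nhdsWithin_le_nhds (gt_mem_nhds one_pos)
  filter_upwards [hs1, self_mem_nhdsWithin] with s hs (hs0 : 0 < s)
  have hs' : (s : ℝ) ≤ 1 := by exact_mod_cast hs.le
  have hs0' : 0 < (s : ℝ) := by exact_mod_cast hs0
  have hme := measurable_exp_neg_mul hη s
  have hm1 : Measurable fun ω => Real.exp (-η ω * s) - 1 := hme.sub measurable_const
  have hm2 : Measurable fun ω => (s : ℝ)⁻¹ * (Real.exp (-η ω * s) - 1) := hm1.const_mul _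
  have hm3 : Measurable fun ω => (s : ℝ)⁻¹ * (Real.exp (-η ω * s) - 1) + η ω := hm2.add hη
  have e1 : rv P 𝕜 _ hm1 = expWeight P 𝕜 hη s - 1 := by
    rw [← rv_one, expWeight, rv_sub hme measurable_const]
  have e2 : rv P 𝕜 _ hm3 =
      rv P 𝕜 (fun _ => (s : ℝ)⁻¹) measurable_const * (expWeight P 𝕜 hη s - 1) + rv P 𝕜 η hη := by
    rw [← e1, rv_mul measurable_const hm1, rv_add hm2 hη]
  -- Three errors: the old difference quotient, the factor `e^{-ηs} - 1` acting on `Cy`, and the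
  -- first-order Taylor remainder of `e^{-ηs}` divided by `s`, acting on `Cx`. The last two are
  -- `O(s)` with random constants.
  have hsplit : (((s : ℝ)⁻¹ : ℝ) : 𝕜) • (expWeight P 𝕜 hη s • U s x - C x) -
      C (y - rv P 𝕜 η hη • x) =
      (expWeight P 𝕜 hη s • ((((s : ℝ)⁻¹ : ℝ) : 𝕜) • (U s x - C x) - C y) +
        rv P 𝕜 _ hm1 • C y) + rv P 𝕜 _ hm3 • C x := by
    rw [e1, e2, map_sub, map_smul, ofReal_smul_eq (P := P), ofReal_smul_eq (P := P)]
    module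
  rw [hsplit]
  filter_upwards [N.add_le_ae (expWeight P 𝕜 hη s • ((((s : ℝ)⁻¹ : ℝ) : 𝕜) • (U s x - C x) - C y) +
      rv P 𝕜 _ hm1 • C y) (rv P 𝕜 _ hm3 • C x),
    N.add_le_ae (expWeight P 𝕜 hη s • ((((s : ℝ)⁻¹ : ℝ) : 𝕜) • (U s x - C x) - C y))
      (rv P 𝕜 _ hm1 • C y),
    N.rv_smul_ae hme ((((s : ℝ)⁻¹ : ℝ) : 𝕜) • (U s x - C x) - C y),
    N.rv_smul_ae hm1 (C y), N.rv_smul_ae hm3 (C x),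
    N.nonneg_ae ((((s : ℝ)⁻¹ : ℝ) : 𝕜) • (U s x - C x) - C y), N.nonneg_ae (C y),
    N.nonneg_ae (C x)] with ω h1 h2 h3 h4 h5 h6 h7 h8
  have habs : |-η ω * s| ≤ |η ω| := by
    rw [abs_mul, abs_neg, abs_of_pos hs0']
    exact mul_le_of_le_one_right (abs_nonneg _) hs'
  have hexp : Real.exp |-η ω * s| ≤ Real.exp |η ω| := Real.exp_le_exp.2 habs
  have b1 : Real.exp (-η ω * s) ≤ Real.exp |η ω| :=
    Real.exp_le_exp.2 ((le_abs_self _).trans habs)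
  have b2 : |Real.exp (-η ω * s) - 1| ≤ |η ω| * Real.exp |η ω| * s := by
    have := abs_exp_sub_exp_le ((le_abs_self _).trans habs) (abs_nonneg (η ω))
    rw [Real.exp_zero, sub_zero, abs_mul, abs_neg, abs_of_pos hs0'] at this
    linarith
  have b3 : |(s : ℝ)⁻¹ * (Real.exp (-η ω * s) - 1) + η ω| ≤ η ω ^ 2 * Real.exp |η ω| * s := by
    have h9 := abs_exp_sub_one_sub_le (-η ω * s)
    have h10 : (s : ℝ)⁻¹ * (Real.exp (-η ω * s) - 1) + η ω =
        (s : ℝ)⁻¹ * (Real.exp (-η ω * s) - 1 - -η ω * s) := by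
      field_simp
      ring
    rw [h10, abs_mul, abs_of_pos (inv_pos.2 hs0'), inv_mul_le_iff₀ hs0']
    calc _ ≤ _ := h9
      _ ≤ (-η ω * s) ^ 2 * Real.exp |η ω| := mul_le_mul_of_nonneg_left hexp (sq_nonneg _)
      _ = _ := by ring
  rw [expWeight] at h1 h2
  rw [h3, h4, abs_of_pos (Real.exp_pos _)] at h2
  rw [h5] at h1
  have c1 := mul_le_mul_of_nonneg_right b1 h6
  have c2 := mul_le_mul_of_nonneg_right b2 h7
  have c3 := mul_le_mul_of_nonneg_right b3 h8
  rw [expWeight]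
  linarith

end ExponentialShift

end RandomNormed

namespace RandomNormed

/-! ### Resolvent, density of the domain, and limit at infinity -/

section Resolvents

variable {Ω : Type*} [MeasurableSpace Ω] {P : Measure Ω} [IsProbabilityMeasure P]
  {𝕜 : Type*} [RCLike 𝕜] {S : Type*} [AddCommGroup S] [Module (Ω →ₘ[P] 𝕜) S]
  [Module 𝕜 S] [IsScalarTower 𝕜 (Ω →ₘ[P] 𝕜) S]
  {N : L0Norm P 𝕜 S} {C : S →ₗ[𝕜] S} {M ξ : Ω →ₘ[P] ℝ} {W : ℝ≥0 → (S →ₗ[𝕜] S)}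

omit [IsScalarTower 𝕜 (Ω →ₘ[P] 𝕜) S] in
theorem IsExpBounded.boundedBy (hM : 0 ≤ M) (hW : IsExpBounded N C M ξ W) (s : ℝ≥0) :
    BoundedBy N (W s) (fun ω => M ω * Real.exp (ξ ω * s)) := by
  obtain ⟨g, hg, hle⟩ := hW.norm_le s
  have hB := hg.boundedBy (hW.bounded s)
  refine ⟨M.measurable.mul (ξ.measurable.mul_const _).exp, ?_, fun z => ?_⟩
  · filter_upwards [AEEqFun.coeFn_le.2 hM, AEEqFun.coeFn_zero (μ := P) (β := ℝ) (α := Ω)]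
      with ω h1 h2
    rw [h2] at h1
    exact mul_nonneg h1 (Real.exp_pos _).le
  · filter_upwards [hB.le z, AEEqFun.coeFn_le.2 hle, AEEqFun.coeFn_mul M (expL0 ξ s),
      coeFn_expL0 ξ s, N.nonneg_ae z] with ω h1 h2 h3 h4 h5
    rw [h3, Pi.mul_apply, h4] at h2
    exact h1.trans (mul_le_mul_of_nonneg_right h2 h5)

/-- The operators of an exponentially bounded `C`-semigroup as `L⁰(F, 𝕜)`-linear maps. -/
noncomputable def IsExpBounded.op (hM : 0 ≤ M) (hW : IsExpBounded N C M ξ W) (s : ℝ≥0) :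
    S →ₗ[Ω →ₘ[P] 𝕜] S :=
  (hW.boundedBy hM s).toLinearMap

theorem IsExpBounded.op_apply (hM : 0 ≤ M) (hW : IsExpBounded N C M ξ W) (s : ℝ≥0) (x : S) :
    hW.op hM s x = W s x := rfl

theorem IsExpBounded.op_zero_apply (hM : 0 ≤ M) (hW : IsExpBounded N C M ξ W) (x : S) :
    hW.op hM 0 x = C x := by
  rw [hW.op_apply, hW.zero]

theorem IsExpBounded.isRightDeriv_iff (hM : 0 ≤ M) (hW : IsExpBounded N C M ξ W) {x y : S} :
    IsGeneratorValue N C W x y ↔ IsRightDeriv N (hW.op hM 0) (fun s => hW.op hM s) x y := by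
  have h : ⇑(hW.op hM 0) = ⇑C := funext (hW.op_zero_apply hM)
  rw [h]
  rfl

theorem IsExpBounded.decaying (hM : 0 ≤ M) (hW : IsExpBounded N C M ξ W) {η : Ω →ₘ[P] ℝ}
    (hη : η ∈ strictAbove ξ) :
    IsDecayingCSemigroup N (hW.op hM 0)
      (fun s => expWeight P 𝕜 η.measurable s • hW.op hM s) M (fun ω => η ω - ξ ω) where
  measurable_M := M.measurable
  measurable_κ := η.measurable.sub ξ.measurable
  M_nonneg := by
    filter_upwards [AEEqFun.coeFn_le.2 hM, AEEqFun.coeFn_zero (μ := P) (β := ℝ) (α := Ω)]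
      with ω h1 h2
    rw [h2] at h1
    exact h1
  κ_pos := Filter.Eventually.mono hη fun ω h => sub_pos.2 h
  injective x y h := hW.injective_C (by rwa [hW.op_zero_apply, hW.op_zero_apply] at h)
  zero x := by rw [NNReal.coe_zero, LinearMap.smul_apply, expWeight_zero, one_smul]
  mul s t x := by
    simp only [LinearMap.smul_apply, map_smul]
    rw [smul_smul, expWeight_mul, hW.op_zero_apply, hW.op_apply, hW.mul, NNReal.coe_add]
    rfl
  le t x := by
    filter_upwards [N.rv_smul_ae (measurable_exp_neg_mul η.measurable t) (hW.op hM t x),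
      (hW.boundedBy hM t).le x] with ω h1 h2
    rw [LinearMap.smul_apply, expWeight, h1, abs_of_pos (Real.exp_pos _)]
    refine (mul_le_mul_of_nonneg_left h2 (Real.exp_pos _).le).trans (le_of_eq ?_)
    have : Real.exp (-(η ω - ξ ω) * t) = Real.exp (-η ω * t) * Real.exp (ξ ω * t) := by
      rw [← Real.exp_add]
      ring_nf
    rw [this]
    ring
  tendsto x t := by
    let := N.topology
    exact tendsto_expWeight_smul η.measurable ((hW.continuous x).tendsto t)

omit [IsScalarTower 𝕜 (Ω →ₘ[P] 𝕜) S] in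
theorem IsExpBounded.eq_of_isGeneratorValue (hW : IsExpBounded N C M ξ W) {x y z : S}
    (hy : IsGeneratorValue N C W x y) (hz : IsGeneratorValue N C W x z) : y = z :=
  hW.injective_C (N.tendsto_unique hy hz)

omit [IsScalarTower 𝕜 (Ω →ₘ[P] 𝕜) S] in
theorem IsExpBounded.generator_eq (hW : IsExpBounded N C M ξ W) {x y : S}
    (h : IsGeneratorValue N C W x y) (hx : x ∈ generatorDomain N C W) :
    generator N C W ⟨x, hx⟩ = y :=
  hW.eq_of_isGeneratorValue hx.choose_spec h

omit [IsScalarTower 𝕜 (Ω →ₘ[P] 𝕜) S] in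
theorem isGeneratorValue_generator (x : generatorDomain N C W) :
    IsGeneratorValue N C W x (generator N C W x) :=
  x.2.choose_spec

omit [IsScalarTower 𝕜 (Ω →ₘ[P] 𝕜) S] in
theorem IsGeneratorValue.sub {x x' y y' : S} (h : IsGeneratorValue N C W x y)
    (h' : IsGeneratorValue N C W x' y') : IsGeneratorValue N C W (x - x') (y - y') := by
  rw [IsGeneratorValue, N.tendsto_iff] at h h' ⊢
  refine (h.add h').mono (Eventually.of_forall fun s => ?_)
  have e : (((s : ℝ)⁻¹ : ℝ) : 𝕜) • (W s (x - x') - C (x - x')) - C (y - y') =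
      ((((s : ℝ)⁻¹ : ℝ) : 𝕜) • (W s x - C x) - C y) -
        ((((s : ℝ)⁻¹ : ℝ) : 𝕜) • (W s x' - C x') - C y') := by
    simp only [map_sub]
    module
  rw [e]
  exact N.sub_le_ae _ _

theorem IsExpBounded.map_isGeneratorValue (hM : 0 ≤ M) (hW : IsExpBounded N C M ξ W) {x y : S}
    (h : IsGeneratorValue N C W x y) {T : S →ₗ[Ω →ₘ[P] 𝕜] S} {b : Ω → ℝ} (hT : BoundedBy N T b)
    (hTW : ∀ s z, T (W s z) = W s (T z)) : IsGeneratorValue N C W (T x) (T y) := by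
  rw [hW.isRightDeriv_iff hM] at h ⊢
  exact h.map hT (fun z => hTW 0 z) hTW

omit [IsScalarTower 𝕜 (Ω →ₘ[P] 𝕜) S] in
theorem IsExpBounded.comm (hW : IsExpBounded N C M ξ W) (s t : ℝ≥0) (x : S) :
    W s (W t x) = W t (W s x) := by
  rw [← hW.mul, ← hW.mul, add_comm]

/-- Every `η > ξ` has a bounded `C`-resolvent. -/
theorem IsExpBounded.exists_resolvent (hS : N.IsComplete) (hM : 0 ≤ M)
    (hW : IsExpBounded N C M ξ W) {η : Ω →ₘ[P] ℝ} (hη : η ∈ strictAbove ξ) :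
    ∃ R : S →ₗ[Ω →ₘ[P] 𝕜] S, BoundedBy N R (fun ω => M ω * (η ω - ξ ω)⁻¹) ∧
      (∀ x, IsGeneratorValue N C W (R x) (ofRealL0 𝕜 η • R x - C x)) ∧
      ∀ x y, IsGeneratorValue N C W x y → R y = ofRealL0 𝕜 η • R x - C x := by
  have := completeSpace_integrable hS
  have hV := hW.decaying hM hη
  refine ⟨hV.laplace, hV.laplace_boundedBy, fun x => ?_, fun x y h => ?_⟩
  -- Multiplying by `e^{ηs}`, the shift with `-η`, recovers `W` from the decaying semigroup and
  -- turns the derivative `-Cx` into `ηRx - Cx`.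
  · have h := (hV.isRightDeriv_laplace x).expWeight_smul η.measurable.neg
    simp only [LinearMap.smul_apply, smul_smul, expWeight_neg_mul, one_smul] at h
    rw [hW.isRightDeriv_iff hM]
    convert h using 1
    have hneg : rv P 𝕜 (-η) η.measurable.neg = -ofRealL0 𝕜 η := by
      rw [ofRealL0_eq_rv]
      refine eq_neg_of_add_eq_zero_left ?_
      rw [rv_add η.measurable.neg η.measurable,
        ← sub_self (rv P 𝕜 η η.measurable), rv_sub]
      exact rv_congr _ _ (Eventually.of_forall fun ω => by simp)
    rw [hneg, hW.op_zero_apply]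
    module
  · rw [hW.isRightDeriv_iff hM] at h
    have h1 := hV.laplace_of_isRightDeriv (h.expWeight_smul η.measurable)
    rw [map_sub, map_smul, hW.op_zero_apply, ← ofRealL0_eq_rv, sub_eq_iff_eq_add] at h1
    rw [h1]
    abel

omit [IsProbabilityMeasure P] in
theorem add_one_mem_strictAbove (ξ : Ω →ₘ[P] ℝ) : ξ + 1 ∈ strictAbove ξ := by
  change ∀ᵐ ω ∂P, _
  filter_upwards [AEEqFun.coeFn_add ξ 1, AEEqFun.coeFn_one (α := Ω) (μ := P) (β := ℝ)] with ω h1 h2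
  rw [h1, Pi.add_apply, h2]
  simp

/-- From `ARx = ηRx - Cx` one gets `C²x = lim (ηC - s⁻¹(W(s) - C))Rx` as `s → 0+`. Every term lies
in `D(A)`, which is stable under `W(s)`, `C` and `L⁰`-scalars. The range of `C²` is dense because
`C` is continuous with dense range. -/
theorem IsExpBounded.dense_generatorDomain (hS : N.IsComplete) (hM : 0 ≤ M)
    (hW : IsExpBounded N C M ξ W) (hC : @Dense S N.topology (Set.range C)) :
    @Dense S N.topology (generatorDomain N C W) := by
  let := N.topology
  obtain ⟨R, -, hR, -⟩ := hW.exists_resolvent hS hM (add_one_mem_strictAbove ξ)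
  set H := ofRealL0 𝕜 (ξ + 1) with hH
  have hCC : Dense (Set.range (C ∘ C)) := by
    have hcont : Continuous C := by
      refine continuous_iff_continuousAt.2 fun x => ?_
      have h := (hW.boundedBy hM 0).tendsto (T := hW.op hM 0) (z := id) (l := 𝓝 x) tendsto_id
      have e : ⇑(hW.op hM 0) = ⇑C := funext (hW.op_zero_apply hM)
      rw [e] at h
      exact h
    exact DenseRange.comp (f := C) (g := C) hC hC hcont
  refine Dense.of_closure (hCC.mono ?_)
  rintro _ ⟨x, rfl⟩
  rw [N.mem_closure_iff]
  intro ε hε δ hδ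
  have h1 := N.tendsto_iff.1 (hR x)
  obtain ⟨s, hs⟩ := (h1 ε hε δ hδ).exists
  let T : S →ₗ[Ω →ₘ[P] 𝕜] S :=
    (H • hW.op hM 0) - rv P 𝕜 (fun _ => (s : ℝ)⁻¹) measurable_const • (hW.op hM s - hW.op hM 0)
  have hop : ∀ t, IsGeneratorValue N C W (hW.op hM t (R x)) (hW.op hM t (H • R x - C x)) :=
    fun t => hW.map_isGeneratorValue hM (hR x) (hW.boundedBy hM t) fun r w => hW.comm _ _ _
  have hsm : ∀ (ζ : Ω →ₘ[P] 𝕜) {a b : S}, IsGeneratorValue N C W a b →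
      IsGeneratorValue N C W (ζ • a) (ζ • b) := fun ζ a b h =>
    hW.map_isGeneratorValue hM h (boundedBy_lsmul N ζ)
      fun r w => ((hW.op hM r).map_smul ζ w).symm
  refine ⟨T (R x), ⟨T (H • R x - C x), ?_⟩, ?_⟩
  · exact (hsm H (hop 0)).sub (hsm _ ((hop s).sub (hop 0)))
  · have e : C (C x) - T (R x) =
        (((s : ℝ)⁻¹ : ℝ) : 𝕜) • (W s (R x) - C (R x)) - C (H • R x - C x) := by
      have e1 : C (H • R x) = H • C (R x) := by
        have := (hW.op hM 0).map_smul H (R x)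
        rwa [hW.op_zero_apply, hW.op_zero_apply] at this
      simp only [T, LinearMap.sub_apply, LinearMap.smul_apply, hW.op_zero_apply, hW.op_apply]
      rw [map_sub, e1, ofReal_smul_eq (P := P)]
      abel
    rw [Function.comp, e]
    exact hs

theorem eventually_atInfinity (ξ : Ω →ₘ[P] ℝ) (K : ℝ) {δ : ℝ} (hδ : 0 < δ) :
    ∀ᶠ η : strictAbove ξ in comap Subtype.val (atInfinity P),
      P.real {ω | (η : Ω →ₘ[P] ℝ) ω ≤ K} < δ := by
  have h : {η : Ω →ₘ[P] ℝ | 1 - δ < P.real {ω | K < η ω}} ∈ atInfinity P :=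
    mem_iInf_of_mem K (mem_iInf_of_mem δ (mem_iInf_of_mem hδ (mem_principal_self _)))
  filter_upwards [preimage_mem_comap h] with η (hη : 1 - δ < P.real {ω | K < (η : Ω →ₘ[P] ℝ) ω})
  have hm : MeasurableSet {ω | K < (η : Ω →ₘ[P] ℝ) ω} :=
    measurableSet_lt measurable_const (η : Ω →ₘ[P] ℝ).measurable
  have hc : {ω | (η : Ω →ₘ[P] ℝ) ω ≤ K} = {ω | K < (η : Ω →ₘ[P] ℝ) ω}ᶜ := by
    ext ω
    simp
  rw [hc, probReal_compl_eq_one_sub hm]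
  linarith

/-- For `x'` in `D(A)` near `x`, with `y = Ax'`, the error at `x` is the error at `x - x'` plus `R_η
y`. Since `M`, `ξ` and `‖y‖` are unbounded, the estimates hold only off five exceptional events of
probability below `δ/5` each. -/
theorem IsExpBounded.tendsto_smul_resolvent (hS : N.IsComplete) (hM : 0 ≤ M)
    (hW : IsExpBounded N C M ξ W) (hC : @Dense S N.topology (Set.range C))
    {R : strictAbove ξ → S →ₗ[Ω →ₘ[P] 𝕜] S}
    (hRb : ∀ η, BoundedBy N (R η) (fun ω => M ω * ((η : Ω →ₘ[P] ℝ) ω - ξ ω)⁻¹))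
    (hRA : ∀ η x y, IsGeneratorValue N C W x y →
      R η y = ofRealL0 𝕜 (η : Ω →ₘ[P] ℝ) • R η x - C x) (x : S) :
    Tendsto (fun η : strictAbove ξ => ofRealL0 𝕜 (η : Ω →ₘ[P] ℝ) • R η x)
      (comap Subtype.val (atInfinity P)) (@nhds S N.topology (C x)) := by
  let := N.topology
  rw [N.tendsto_iff]
  intro ε hε δ hδ
  have hδ5 : 0 < δ / 5 := by linarith
  -- The factor `3M` is `2M` from `ηR_η` plus `M` from `C`.
  obtain ⟨n, hn, hn'⟩ := TendstoZero.exists_measureReal_lt (P := P) (fun ω => 3 * M ω)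
    (M.measurable.const_mul 3) hδ5
  obtain ⟨x', ⟨y, hy⟩, hx'⟩ := N.mem_closure_iff.1 (hW.dense_generatorDomain hS hM hC x)
    (ε / (2 * n)) (by positivity) (δ / 5) hδ5
  obtain ⟨n₂, hn₂, hn₂'⟩ := TendstoZero.exists_measureReal_lt (P := P)
    (fun ω => 4 * M ω * N y ω / ε)
    (((M.measurable.const_mul 4).mul (N y).measurable).div_const ε) hδ5
  obtain ⟨n₃, hn₃, hn₃'⟩ := TendstoZero.exists_measureReal_lt (P := P)
    (fun ω => 2 * |ξ ω|) (ξ.measurable.abs.const_mul 2) hδ5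
  filter_upwards [eventually_atInfinity ξ (max n₂ n₃) hδ5] with η hη
  set E1 := {ω | n ≤ 3 * M ω}
  set E2 := {ω | ε / (2 * n) ≤ N (x - x') ω}
  set E3 := {ω | n₂ ≤ 4 * M ω * N y ω / ε}
  set E4 := {ω | n₃ ≤ 2 * |ξ ω|}
  set E5 := {ω | (η : Ω →ₘ[P] ℝ) ω ≤ max n₂ n₃}
  set H := ofRealL0 𝕜 (η : Ω →ₘ[P] ℝ) with hH
  have hsplit : H • R η x - C x = (H • R η (x - x') - C (x - x')) + R η y := by
    rw [hRA η x' y hy, map_sub, map_sub, ← hH]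
    module
  have hsub : P.real {ω | ε ≤ N (H • R η x - C x) ω} ≤ P.real (E1 ∪ E2 ∪ E3 ∪ E4 ∪ E5) := by
    refine measureReal_le_of_ae ?_
    have hCb := (hW.boundedBy hM 0).le (x - x')
    rw [hW.zero] at hCb
    have hHn := N.rv_smul_ae (η : Ω →ₘ[P] ℝ).measurable (R η (x - x'))
    rw [← ofRealL0_eq_rv, ← hH] at hHn
    rw [hsplit]
    filter_upwards [N.add_le_ae (H • R η (x - x') - C (x - x')) (R η y),
      N.sub_le_ae (H • R η (x - x')) (C (x - x')), hHn, hCb, (hRb η).le (x - x'), (hRb η).le y,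
      N.nonneg_ae y, N.nonneg_ae (x - x'), AEEqFun.coeFn_le.2 hM,
      AEEqFun.coeFn_zero (μ := P) (β := ℝ) (α := Ω)] with ω h1 h2 h3 h4 h5 h6 h7 h8 h9 h10 h11
    rw [h10] at h9
    have h9 : 0 ≤ M ω := h9
    have h11 : ε ≤ _ := h11
    by_contra hcon
    simp only [Set.mem_union, not_or] at hcon
    obtain ⟨⟨⟨⟨c1, c2⟩, c3⟩, c4⟩, c5⟩ := hcon
    have c1 : 3 * M ω < n := not_le.1 c1
    have c2 : N (x - x') ω < ε / (2 * n) := not_le.1 c2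
    have c3 : 4 * M ω * N y ω / ε < n₂ := not_le.1 c3
    have c4 : 2 * |ξ ω| < n₃ := not_le.1 c4
    have c5 : max n₂ n₃ < (η : Ω →ₘ[P] ℝ) ω := not_le.1 c5
    have c6 := (le_max_left n₂ n₃).trans_lt c5
    have c7 := (le_max_right n₂ n₃).trans_lt c5
    set e := (η : Ω →ₘ[P] ℝ) ω
    have he : 0 < e := hn₂.trans c6
    -- Since `e > 2|ξ|`, the random gap `e - ξ` is at least `e/2`; this makes `ηR_η` bounded by `2M`
    -- and `R_η y` by `2M‖y‖/e`, which is below `ε/2` as `e > 4M‖y‖/ε`.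
    have hgap : e / 2 ≤ e - ξ ω := by linarith [le_abs_self (ξ ω)]
    have hinv : (e - ξ ω)⁻¹ ≤ 2 / e := by
      rw [← inv_div]
      exact inv_anti₀ (by positivity) hgap
    rw [NNReal.coe_zero, mul_zero, Real.exp_zero, mul_one] at h4
    rw [h3, abs_of_pos he] at h2
    have k1 : e * N (R η (x - x')) ω ≤ 2 * M ω * N (x - x') ω := by
      have : N (R η (x - x')) ω ≤ M ω * (2 / e) * N (x - x') ω :=
        h5.trans (by gcongr)
      calc e * N (R η (x - x')) ω ≤ e * (M ω * (2 / e) * N (x - x') ω) := by gcongr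
        _ = 2 * M ω * N (x - x') ω := by field_simp
    have k2 : N (R η y) ω < ε / 2 := by
      have h12 : N (R η y) ω ≤ M ω * (2 / e) * N y ω := h6.trans (by gcongr)
      refine h12.trans_lt ?_
      rw [div_lt_iff₀ hε] at c3
      have : M ω * (2 / e) * N y ω = 2 * M ω * N y ω / e := by ring
      rw [this, div_lt_iff₀ he]
      nlinarith
    have k3 : 3 * M ω * N (x - x') ω ≤ ε / 2 := by
      calc 3 * M ω * N (x - x') ω ≤ n * (ε / (2 * n)) := by gcongr
        _ = ε / 2 := by field_simp
    linarith
  have hu := measureReal_union_le (μ := P) (E1 ∪ E2 ∪ E3 ∪ E4) E5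
  have hu1 := measureReal_union_le (μ := P) (E1 ∪ E2 ∪ E3) E4
  have hu2 := measureReal_union_le (μ := P) (E1 ∪ E2) E3
  have hu3 := measureReal_union_le (μ := P) E1 E2
  linarith

end Resolvents

end RandomNormed

/-! ### Resolvent set and both limits -/

theorem lemma4p10 {Ω : Type*} [MeasurableSpace Ω] (P : Measure Ω) [IsProbabilityMeasure P]
    {𝕜 : Type*} [RCLike 𝕜] {S : Type*} [AddCommGroup S] [Module (Ω →ₘ[P] 𝕜) S]
    [Module 𝕜 S] [IsScalarTower 𝕜 (Ω →ₘ[P] 𝕜) S]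
    (N : RandomNormed.L0Norm P 𝕜 S) (hS : N.IsComplete)
    (C : S →ₗ[𝕜] S) (M ξ : Ω →ₘ[P] ℝ) (hM : 0 ≤ M) (W : ℝ≥0 → (S →ₗ[𝕜] S))
    (hW : RandomNormed.IsExpBounded N C M ξ W)
    (hC : @Dense S N.topology (Set.range C)) :
    ∃ hρ : ∀ η : RandomNormed.strictAbove ξ,
        RandomNormed.ofRealL0 𝕜 (η : Ω →ₘ[P] ℝ) ∈
          RandomNormed.cResolventSet C (RandomNormed.generator N C W),
      (∀ x : S,
        Tendsto
          (fun η : RandomNormed.strictAbove ξ =>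
            RandomNormed.ofRealL0 𝕜 (η : Ω →ₘ[P] ℝ) •
              (RandomNormed.cResolvent (hρ η) x : S))
          (comap Subtype.val (RandomNormed.atInfinity P)) (@nhds S N.topology (C x))) ∧
      (∀ x : RandomNormed.generatorDomain N C W,
        (∀ η : RandomNormed.strictAbove ξ,
          RandomNormed.ofRealL0 𝕜 (η : Ω →ₘ[P] ℝ) •
              RandomNormed.generator N C W (RandomNormed.cResolvent (hρ η) x) =
            RandomNormed.ofRealL0 𝕜 (η : Ω →ₘ[P] ℝ) •
              (RandomNormed.cResolvent (hρ η) (RandomNormed.generator N C W x) : S)) ∧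
        Tendsto
          (fun η : RandomNormed.strictAbove ξ =>
            RandomNormed.ofRealL0 𝕜 (η : Ω →ₘ[P] ℝ) •
              RandomNormed.generator N C W (RandomNormed.cResolvent (hρ η) x))
          (comap Subtype.val (RandomNormed.atInfinity P))
          (@nhds S N.topology (C (RandomNormed.generator N C W x))) ∧
        Tendsto
          (fun η : RandomNormed.strictAbove ξ =>
            RandomNormed.ofRealL0 𝕜 (η : Ω →ₘ[P] ℝ) •
              (RandomNormed.cResolvent (hρ η) (RandomNormed.generator N C W x) : S))
          (comap Subtype.val (RandomNormed.atInfinity P))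
          (@nhds S N.topology (C (RandomNormed.generator N C W x)))) := by
  open RandomNormed in
  choose R hRb hRgen hRA using fun η : strictAbove ξ => hW.exists_resolvent hS hM η.2
  have hdom : ∀ η x, R η x ∈ generatorDomain N C W := fun η x => ⟨_, hRgen η x⟩
  have hsub : ∀ (η : strictAbove ξ) x, subOp (generator N C W) (ofRealL0 𝕜 (η : Ω →ₘ[P] ℝ)) ⟨R η x, hdom η x⟩ =
      C x := by
    intro η x
    rw [subOp, hW.generator_eq (hRgen η x), sub_sub_cancel]
  have hinj : ∀ η : strictAbove ξ,
      Function.Injective (subOp (generator N C W) (ofRealL0 𝕜 (η : Ω →ₘ[P] ℝ))) := by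
    intro η z₁ z₂ h
    -- For `z = z₁ - z₂` one has `Az = ηz`; comparing `R(Az) = ηRz - Cz` with `R(ηz) = ηRz` leaves
    -- `Cz = 0`.
    have hz := (isGeneratorValue_generator z₁).sub (isGeneratorValue_generator z₂)
    have hR := hRA η _ _ hz
    have hg : generator N C W z₁ - generator N C W z₂ =
        ofRealL0 𝕜 (η : Ω →ₘ[P] ℝ) • ((z₁ : S) - z₂) := by
      rw [smul_sub]
      exact (sub_eq_sub_iff_sub_eq_sub.1 h).symm
    rw [hg, map_smul, eq_comm, sub_eq_self] at hR
    exact Subtype.ext (sub_eq_zero.1 (hW.injective_C (hR.trans (map_zero C).symm)))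
  have hρ : ∀ η : strictAbove ξ,
      ofRealL0 𝕜 (η : Ω →ₘ[P] ℝ) ∈ cResolventSet C (generator N C W) := by
    refine fun η => ⟨hinj η, ?_⟩
    rintro _ ⟨x, rfl⟩
    exact ⟨_, hsub η x⟩
  -- Injectivity of `η - A` identifies the chosen preimage of `Cx` with the Laplace transform.
  have hres : ∀ η x, cResolvent (hρ η) x = ⟨R η x, hdom η x⟩ := fun η x =>
    hinj η (((hρ η).2 ⟨x, rfl⟩).choose_spec.trans (hsub η x).symm)
  have hlim := hW.tendsto_smul_resolvent hS hM hC hRb hRA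
  -- Both sides equal `ηRx - Cx`; hence both limits in (b) are instances of (a) at `Ax`.
  have hcomm : ∀ (x : generatorDomain N C W) (η : strictAbove ξ),
      generator N C W (cResolvent (hρ η) x) = R η (generator N C W x) := by
    intro x η
    rw [hres, hW.generator_eq (hRgen η x), hRA η x _ (isGeneratorValue_generator x)]
  refine ⟨hρ, fun x => ?_, fun x => ⟨fun η => ?_, ?_, ?_⟩⟩
  · simpa only [hres] using hlim x
  · rw [hcomm, hres]
  · simpa only [hcomm] using hlim (generator N C W x)
  · simpa only [hres] using hlim (generator N C W x)
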